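/- **Theorem 1 (Local Convergence).** *Setting.* For $\boldsymbol x=(x_0,\dots,x_{n-1})\in\mathbb C^n$ let $\mathcal H(\boldsymbol x)\in\mathbb C^{n_1\times n_2}$ be the Hankel matrix with entries $[\mathcal H(\boldsymbol x)]_{a,b}=x_{a+b}$ ($0\le a<n_1$, $0\le b<n_2$), where $n_1=n_2=(n+1)/2$ if $n$ is odd and $n_1=n_2-1=n/2$ if $n$ is even. Let $\mathcal H^\dagger:\mathbb C^{n_1\times n_2}\to\mathbb C^n$ be its left inverse, which averages each anti-diagonal, and let $c_s=\max\{n/n_1,n/n_2\}$. For $r\ge1$, a matrix $\boldsymbol M\in\mathbb C^{n_1\times n_2}$ of rank $r$ with compact singular value decomposition $\boldsymbol U\boldsymbol\Sigma\boldsymbol V^*$ is called $\nu$-incoherent if every row of $\boldsymbol U$ and of $\boldsymbol V$ has Euclidean norm at most $\sqrt{\nu c_s r/n}$. Singular values are $\sigma_1\ge\sigma_2\ge\cdots$, $\|\cdot\|_2$ is the spectral norm of matrices, and $\|\cdot\|_\infty$ the maximum norm of vectors. *Algorithm (ASAP).* Given $\boldsymbol z\in\mathbb C^n$, $r$, $\beta$,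 $\gamma$ and a starting pair $(\boldsymbol L_0,\boldsymbol x_0)\in\mathbb C^{n_1\times n_2}\times\mathbb C^n$, iterate for $k=0,1,2,\dots$ (until any stopping rule applies) $$\zeta_{k+1}=\beta\gamma^k\sigma_1(\boldsymbol L_k),\quad \boldsymbol s_{k+1}=\mathcal T_{\zeta_{k+1}}(\boldsymbol z-\boldsymbol x_k),\quad \boldsymbol L_{k+1}=\mathcal D_r\mathcal P_{T_k}\mathcal H(\boldsymbol z-\boldsymbol s_{k+1}),\quad \boldsymbol x_{k+1}=\mathcal H^\dagger(\boldsymbol L_{k+1}),$$ where $\mathcal T_\zeta$ keeps the entries of modulus $>\zeta$ and sets all others to $0$; $\mathcal P_{T_k}\boldsymbol M=\boldsymbol U_k\boldsymbol U_k^*\boldsymbol M+\boldsymbol M\boldsymbol V_k\boldsymbol V_k^*-\boldsymbol U_k\boldsymbol U_k^*\boldsymbol M\boldsymbol V_k\boldsymbol V_k^*$ for a singular value decomposition $\boldsymbol L_k=\boldsymbol U_k\boldsymbol\Sigma_k\boldsymbol V_k^*$ with $r$ singular triples; and $\mathcal D_r$ is the rank $r$ truncation of a singular value decomposition (any choice,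 where it is not unique). *Claim.* There is an absolute constant $c>0$ with the following property. Let $n,r\ge1$, let $\boldsymbol x,\boldsymbol s\in\mathbb C^n$ and $\boldsymbol z=\boldsymbol x+\boldsymbol s$. Assume that $\boldsymbol L=\mathcal H(\boldsymbol x)$ has rank $r$ (as is the case for a spectrally $r$-sparse $\boldsymbol x$ with $r\le n_1$) and is $\mu$-incoherent. Let $\sigma_i^x$ be the singular values of $\boldsymbol L$ and $\kappa=\sigma_1^x/\sigma_r^x$. Assume that $\boldsymbol s$ has at most $\alpha n$ nonzero entries, where $$0<\alpha\le\frac{c}{(\mu c_s r\kappa)^2}.$$ Let $\beta=\frac{\mu c_s r}{2\kappa n}$, $\gamma\in\left(\frac1{\sqrt{12}},1\right)$ and $\tau=4\alpha\mu c_s r\kappa$. If $\boldsymbol L_0$ has rank $r$ and is $4\mu\kappa^2$-incoherent, and $$\|\boldsymbol L-\boldsymbol L_0\|_2\le2\tau\sigma_r^x,\qquad \|\boldsymbol x-\boldsymbol x_0\|_\infty\le\frac{\tau-2\tau^2}{8\alpha\kappa n}\sigma_r^x,$$ then all iterates of ASAP satisfy $$\|\boldsymbol L-\boldsymbol L_k\|_2\le2\tau\gamma^k\sigma_r^x,\qquad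 \|\boldsymbol x-\boldsymbol x_k\|_\infty\le\frac{\tau-2\tau^2}{8\alpha\kappa n}\gamma^k\sigma_r^x,$$ and $\boldsymbol L_k$ has rank $r$ and is $4\mu\kappa^2$-incoherent; in this sense ASAP converges linearly, with rate $\gamma$. -/

import Mathlib

open scoped Matrix Matrix.Norms.L2Operator

namespace ASAP

noncomputable section

/-- Number of rows of the (nearly square) Hankel matrix of a signal of length `n`:
`(n + 1) / 2` if `n` is odd and `n / 2` if `n` is even. -/
abbrev rows (n : ℕ) : ℕ := (n + 1) / 2

/-- Number of columns of the Hankel matrix of a signal of length `n`: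
`(n + 1) / 2` if `n` is odd and `n / 2 + 1` if `n` is even. -/
abbrev cols (n : ℕ) : ℕ := n / 2 + 1

/-- The Hankel matrix of a signal: its `(a, b)` entry is `x (a + b)`. -/
def hankel {n : ℕ} (x : Fin n → ℂ) : Matrix (Fin (rows n)) (Fin (cols n)) ℂ :=
  Matrix.of fun a b => x ⟨a.val + b.val, by
    have ha := a.isLt
    have hb := b.isLt
    simp only [rows, cols] at ha hb
    omega⟩

/-- The positions of the `t`-th anti-diagonal. -/
def antidiag {n : ℕ} (t : Fin n) : Finset (Fin (rows n) × Fin (cols n)) :=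
  Finset.univ.filter fun p => p.1.val + p.2.val = t.val

/-- The left inverse of `hankel`: the average over each anti-diagonal. -/
def hankelInv {n : ℕ} (M : Matrix (Fin (rows n)) (Fin (cols n)) ℂ) : Fin n → ℂ :=
  fun t => (1 / ((antidiag t).card : ℂ)) * ∑ p ∈ antidiag t, M p.1 p.2

/-- Singular values in decreasing order, with multiplicity. They are indexed from zero:
`sv M 0` is the largest one, and `sv M (r - 1)` is the `r`-th one. -/
def sv {m p : ℕ} (M : Matrix (Fin m) (Fin p) ℂ) (i : ℕ) : ℝ :=
  (Matrix.toEuclideanLin M).singularValues i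

/-- The condition number of a matrix of rank `r`, the quotient of its largest singular value
by its `r`-th one. -/
def cond {m p : ℕ} (r : ℕ) (M : Matrix (Fin m) (Fin p) ℂ) : ℝ := sv M 0 / sv M (r - 1)

/-- `M = U Σ Vᴴ` is a (reduced) singular value decomposition with `q` singular triples:
orthonormal columns, nonnegative singular values in decreasing order. -/
structure IsSVD {m p q : ℕ} (M : Matrix (Fin m) (Fin p) ℂ) (U : Matrix (Fin m) (Fin q) ℂ)
    (σ : Fin q → ℝ) (V : Matrix (Fin p) (Fin q) ℂ) : Prop where
  left_orthonormal : Uᴴ * U = 1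
  right_orthonormal : Vᴴ * V = 1
  nonneg : ∀ i, 0 ≤ σ i
  antitone : Antitone σ
  eq_mul : M = U * Matrix.diagonal (fun i => (σ i : ℂ)) * Vᴴ

/-- `N` is a truncated singular value decomposition of `M`, a nearest matrix of rank at most `r`:
only the first `r` singular triples of `M` are kept. It is a relation, since `N` is not unique
when the `r`-th and the next singular value of `M` agree. -/
def IsTruncatedSVD {m p : ℕ} (r : ℕ) (M N : Matrix (Fin m) (Fin p) ℂ) : Prop :=
  ∃ (q : ℕ) (U : Matrix (Fin m) (Fin q) ℂ) (σ : Fin q → ℝ) (V : Matrix (Fin p) (Fin q) ℂ),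
    IsSVD M U σ V ∧
      N = U * Matrix.diagonal (fun i => if i.val < r then (σ i : ℂ) else 0) * Vᴴ

/-- The constant `c_s = max {n / n₁, n / n₂}`. -/
def cs (n : ℕ) : ℝ := max ((n : ℝ) / (rows n : ℝ)) ((n : ℝ) / (cols n : ℝ))

/-- Every row of `U` has Euclidean norm at most `b`. -/
def RowNormLE {m q : ℕ} (U : Matrix (Fin m) (Fin q) ℂ) (b : ℝ) : Prop :=
  ∀ i, Real.sqrt (∑ j, ‖U i j‖ ^ 2) ≤ b

/-- `M` has rank `r` and is `ν`-incoherent: the rows of the two factors of its compact singular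
value decomposition have norm at most `√(ν c_s r / n)`. For a matrix of rank `r` the norms of
these rows do not depend on the choice of the decomposition. -/
def IsIncoherent {n : ℕ} (r : ℕ) (ν : ℝ) (M : Matrix (Fin (rows n)) (Fin (cols n)) ℂ) : Prop :=
  M.rank = r ∧
    ∃ (U : Matrix (Fin (rows n)) (Fin r) ℂ) (σ : Fin r → ℝ) (V : Matrix (Fin (cols n)) (Fin r) ℂ),
      IsSVD M U σ V ∧
        RowNormLE U (Real.sqrt (ν * cs n * r / n)) ∧ RowNormLE V (Real.sqrt (ν * cs n * r / n))

/-- `s` has at most `α n` nonzero entries. -/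
def IsSparse {n : ℕ} (α : ℝ) (s : Fin n → ℂ) : Prop := (hammingNorm s : ℝ) ≤ α * n

open Classical in
/-- Entrywise hard thresholding at level `ζ`. -/
def hardThreshold {n : ℕ} (ζ : ℝ) (v : Fin n → ℂ) : Fin n → ℂ :=
  fun t => if ζ < ‖v t‖ then v t else 0

/-- The projection of `M` onto the space of all matrices `U Aᴴ + B Vᴴ`. -/
def tangentProj {m p r : ℕ} (U : Matrix (Fin m) (Fin r) ℂ) (V : Matrix (Fin p) (Fin r) ℂ)
    (M : Matrix (Fin m) (Fin p) ℂ) : Matrix (Fin m) (Fin p) ℂ :=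
  U * Uᴴ * M + M * (V * Vᴴ) - U * Uᴴ * M * (V * Vᴴ)

/-- One iteration, number `k`, of accelerated structured alternating projections. From `(L, x)`
it computes `(s', L', x')` by
`s' = T_ζ (z - x)` with `ζ = β γ ^ k σ₁(L)`, `L' = D_r P_T H(z - s')`, `x' = H†(L')`. -/
def IsStep {n : ℕ} (z : Fin n → ℂ) (r : ℕ) (β γ : ℝ) (k : ℕ)
    (L : Matrix (Fin (rows n)) (Fin (cols n)) ℂ) (x : Fin n → ℂ)
    (s' : Fin n → ℂ) (L' : Matrix (Fin (rows n)) (Fin (cols n)) ℂ) (x' : Fin n → ℂ) : Prop :=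
  s' = hardThreshold (β * γ ^ k * sv L 0) (z - x) ∧
  (∃ (U : Matrix (Fin (rows n)) (Fin r) ℂ) (σ : Fin r → ℝ) (V : Matrix (Fin (cols n)) (Fin r) ℂ),
    IsSVD L U σ V ∧ IsTruncatedSVD r (tangentProj U V (hankel (z - s'))) L') ∧
  x' = hankelInv L'

/-- `(L k, x k)`, `k ≤ K`, are the iterates of a run of `K` iterations that starts at `(L 0, x 0)`;
`s (k + 1)` are the estimates of the corruption. The length `K` is arbitrary, so that any stopping
rule is covered. -/
def IsRun {n : ℕ} (z : Fin n → ℂ) (r : ℕ) (β γ : ℝ) (K : ℕ)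
    (L : ℕ → Matrix (Fin (rows n)) (Fin (cols n)) ℂ) (x s : ℕ → Fin n → ℂ) : Prop :=
  ∀ k < K, IsStep z r β γ k (L k) (x k) (s (k + 1)) (L (k + 1)) (x (k + 1))

end

end ASAP

/-!
Local linear convergence of ASAP. With `ρ² = μ c_s r / n` and `h = γ ^ k σ_r`, the invariant at
step `k` is `‖L - L_k‖ ≤ 2 τ h`, `‖x - x_k‖_∞ ≤ (1 - 2 τ) ρ² h / 2`, and incoherence of `L_k`
(rows at most `2 κ ρ`).

The threshold lies between `‖x - x_k‖_∞` and `(1 + 2 τ) ρ² h / 2`, so that `s - s_{k+1}` is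
supported on the support of `s` with entries at most `ρ² h`. Hence the rows and columns of
`E = H(s - s_{k+1})` have absolute sums at most `α n ρ² h = τ h / (4 κ)`, which bounds `‖E‖` by the
Schur test and the rows of `E V_k` by incoherence. The matrix that is truncated is `A = L + W`
with `W = P_T E - (1 - P) L (1 - Q)`, where the last term is of second order
(`norm_tangent_defect_le`); so `‖W‖ ≤ (1 / 2 + O(τ)) τ h`, and the rows of `W` and of its adjoint
are `O(τ κ) ρ h` (`norm_rowMat_tangentProj_add_sub_le`).

The usual estimate `‖D_r A - L‖ ≤ 2 ‖W‖` would lose the rate `γ > 1 / √12`. But `A` lies in the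
tangent space at `L_k`: its block off the column and row spaces of `L_k` vanishes, so that
`σ_{r+1}(A) = O(τ² h)` by the size of the Schur complement (`norm_tangentProj_mul_le`). Therefore
`‖L_{k+1} - L‖ ≤ ‖W‖ + O(τ² h) ≤ 0.52 τ h ≤ 2 τ γ h`.

Incoherence of `L_{k+1} = U' Σ' V'*` follows from `U' = A V' Σ'⁻¹ = U (U* L V' Σ'⁻¹) + W V' Σ'⁻¹`
(`norm_rowMat_left_factor_le`), which gives rows at most `2 ρ`. The entrywise bound comes from
`L_{k+1} - L = P' W Q' - (1 - P') L - P' L (1 - Q')`, where the rows of `(1 - P') L` are small since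
`(1 - P') A = A - L_{k+1} = A (1 - Q')` (`norm_rowMat_one_sub_proj_mul_le`). It is of order
`τ κ ρ² h`, and `τ κ ≤ 4 c` because incoherence forces `μ c_s r ≥ 1`. Averaging over anti-diagonals
turns it into the bound for `x - x_{k+1}`.

Throughout, vectors and single rows are matrices with one column or one row, so that all estimates
are submultiplicativity of the spectral norm.
-/

namespace ASAP

/-! ### Spectral norms, rows and entries -/

section Norms

variable {l m p q : ℕ}

theorem norm_mul_self_conjTranspose (A : Matrix (Fin m) (Fin p) ℂ) : ‖A * Aᴴ‖ = ‖A‖ * ‖A‖ := by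
  simpa [Matrix.l2_opNorm_conjTranspose] using Matrix.l2_opNorm_conjTranspose_mul_self Aᴴ

/-- Matrices with the same Gram matrix act with the same norms. -/
theorem norm_mul_eq_of_gram_eq {A : Matrix (Fin m) (Fin p) ℂ} {B : Matrix (Fin l) (Fin p) ℂ}
    (h : Aᴴ * A = Bᴴ * B) (Y : Matrix (Fin p) (Fin q) ℂ) : ‖A * Y‖ = ‖B * Y‖ := by
  have key : (A * Y)ᴴ * (A * Y) = (B * Y)ᴴ * (B * Y) := by
    rw [Matrix.conjTranspose_mul, Matrix.conjTranspose_mul, Matrix.mul_assoc, Matrix.mul_assoc,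
      ← Matrix.mul_assoc Aᴴ, ← Matrix.mul_assoc Bᴴ, h]
  have h1 := Matrix.l2_opNorm_conjTranspose_mul_self (A * Y)
  rw [key, Matrix.l2_opNorm_conjTranspose_mul_self] at h1
  nlinarith [norm_nonneg (A * Y), norm_nonneg (B * Y)]

theorem norm_isometry_mul {U : Matrix (Fin m) (Fin p) ℂ} (hU : Uᴴ * U = 1)
    (Y : Matrix (Fin p) (Fin q) ℂ) : ‖U * Y‖ = ‖Y‖ := by
  rw [norm_mul_eq_of_gram_eq (B := 1) (by rw [hU, Matrix.conjTranspose_one, Matrix.one_mul]),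
    Matrix.one_mul]

theorem norm_one_le (p : ℕ) : ‖(1 : Matrix (Fin p) (Fin p) ℂ)‖ ≤ 1 := by
  rw [← Matrix.diagonal_one, Matrix.l2_opNorm_diagonal]
  exact (pi_norm_le_iff_of_nonneg zero_le_one).2 fun i => by simp

theorem norm_isometry_le {U : Matrix (Fin m) (Fin p) ℂ} (hU : Uᴴ * U = 1) : ‖U‖ ≤ 1 := by
  have h := norm_isometry_mul hU (1 : Matrix (Fin p) (Fin p) ℂ)
  rw [Matrix.mul_one] at h
  exact h ▸ norm_one_le p

theorem norm_conjTranspose_isometry_le {U : Matrix (Fin m) (Fin p) ℂ} (hU : Uᴴ * U = 1) :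
    ‖Uᴴ‖ ≤ 1 := by
  rw [Matrix.l2_opNorm_conjTranspose]
  exact norm_isometry_le hU

theorem norm_proj_le {U : Matrix (Fin m) (Fin p) ℂ} (hU : Uᴴ * U = 1) : ‖U * Uᴴ‖ ≤ 1 := by
  rw [norm_isometry_mul hU]
  exact norm_conjTranspose_isometry_le hU

theorem norm_one_sub_proj_le {U : Matrix (Fin m) (Fin p) ℂ} (hU : Uᴴ * U = 1) :
    ‖1 - U * Uᴴ‖ ≤ 1 := by
  have key : (1 - U * Uᴴ)ᴴ * (1 - U * Uᴴ) = 1 - U * Uᴴ := by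
    have h : U * Uᴴ * (U * Uᴴ) = U * Uᴴ := by
      rw [Matrix.mul_assoc, ← Matrix.mul_assoc Uᴴ, hU, Matrix.one_mul]
    rw [Matrix.conjTranspose_sub, Matrix.conjTranspose_mul, Matrix.conjTranspose_conjTranspose,
      Matrix.conjTranspose_one, Matrix.mul_sub, Matrix.sub_mul, Matrix.sub_mul, h]
    simp
  have h1 := Matrix.l2_opNorm_conjTranspose_mul_self (1 - U * Uᴴ)
  rw [key] at h1
  nlinarith [norm_nonneg (1 - U * Uᴴ)]

theorem norm_mul_le_right {A : Matrix (Fin l) (Fin m) ℂ} (hA : ‖A‖ ≤ 1)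
    (B : Matrix (Fin m) (Fin p) ℂ) : ‖A * B‖ ≤ ‖B‖ :=
  (Matrix.l2_opNorm_mul A B).trans (mul_le_of_le_one_left (norm_nonneg _) hA)

theorem norm_mul_le_left (A : Matrix (Fin l) (Fin m) ℂ) {B : Matrix (Fin m) (Fin p) ℂ}
    (hB : ‖B‖ ≤ 1) : ‖A * B‖ ≤ ‖A‖ :=
  (Matrix.l2_opNorm_mul A B).trans (mul_le_of_le_one_right (norm_nonneg _) hB)

/-- The `i`-th row of `M` as a matrix with one row; its spectral norm is its Euclidean norm. -/
def rowMat (M : Matrix (Fin m) (Fin p) ℂ) (i : Fin m) : Matrix (Fin 1) (Fin p) ℂ :=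
  Matrix.of fun _ j => M i j

theorem rowMat_mul (A : Matrix (Fin m) (Fin p) ℂ) (B : Matrix (Fin p) (Fin q) ℂ) (i : Fin m) :
    rowMat (A * B) i = rowMat A i * B := by
  ext a j
  simp [rowMat, Matrix.mul_apply]

theorem rowMat_add (A B : Matrix (Fin m) (Fin p) ℂ) (i : Fin m) :
    rowMat (A + B) i = rowMat A i + rowMat B i := rfl

theorem rowMat_sub (A B : Matrix (Fin m) (Fin p) ℂ) (i : Fin m) :
    rowMat (A - B) i = rowMat A i - rowMat B i := rfl

theorem norm_rowMat_sq (M : Matrix (Fin m) (Fin p) ℂ) (i : Fin m) :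
    ‖rowMat M i‖ ^ 2 = ∑ j, ‖M i j‖ ^ 2 := by
  have h : rowMat M i * (rowMat M i)ᴴ
      = Matrix.diagonal fun _ => ((∑ j, ‖M i j‖ ^ 2 : ℝ) : ℂ) := by
    ext a b
    rw [Subsingleton.elim a 0, Subsingleton.elim b 0, Matrix.diagonal_apply_eq, Matrix.mul_apply]
    push_cast
    refine Finset.sum_congr rfl fun j _ => ?_
    simp [rowMat, Complex.mul_conj, Complex.normSq_eq_norm_sq]
  have h2 := norm_mul_self_conjTranspose (rowMat M i)
  rw [h, Matrix.l2_opNorm_diagonal, pi_norm_const, Complex.norm_real, Real.norm_of_nonneg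
    (by positivity)] at h2
  rw [sq, ← h2]

theorem norm_rowMat (M : Matrix (Fin m) (Fin p) ℂ) (i : Fin m) :
    ‖rowMat M i‖ = Real.sqrt (∑ j, ‖M i j‖ ^ 2) := by
  rw [← norm_rowMat_sq, Real.sqrt_sq (norm_nonneg _)]

theorem rowNormLE_iff {M : Matrix (Fin m) (Fin p) ℂ} {b : ℝ} :
    RowNormLE M b ↔ ∀ i, ‖rowMat M i‖ ≤ b := by
  simp only [RowNormLE, norm_rowMat]

theorem norm_entry_le_rowMat (M : Matrix (Fin m) (Fin p) ℂ) (i : Fin m) (j : Fin p) :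
    ‖M i j‖ ≤ ‖rowMat M i‖ := by
  rw [norm_rowMat]
  refine Real.le_sqrt_of_sq_le ?_
  exact Finset.single_le_sum (f := fun j => ‖M i j‖ ^ 2) (fun _ _ => by positivity)
    (Finset.mem_univ j)

theorem norm_rowMat_mul_le (A : Matrix (Fin m) (Fin p) ℂ) (B : Matrix (Fin p) (Fin q) ℂ)
    (i : Fin m) : ‖rowMat (A * B) i‖ ≤ ‖rowMat A i‖ * ‖B‖ := by
  rw [rowMat_mul]
  exact Matrix.l2_opNorm_mul _ _

theorem norm_rowMat_le (A : Matrix (Fin m) (Fin p) ℂ) (i : Fin m) : ‖rowMat A i‖ ≤ ‖A‖ := by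
  have h : rowMat A i = rowMat (1 : Matrix (Fin m) (Fin m) ℂ) i * A := by
    rw [← rowMat_mul, Matrix.one_mul]
  have h1 : ‖rowMat (1 : Matrix (Fin m) (Fin m) ℂ) i‖ ≤ 1 := by
    rw [norm_rowMat, Real.sqrt_le_one]
    rw [Finset.sum_eq_single i]
    · simp
    · intro b _ hb
      simp [Matrix.one_apply_ne hb.symm]
    · simp
  rw [h]
  exact norm_mul_le_right h1 A

theorem norm_mul_entry_le (A : Matrix (Fin m) (Fin p) ℂ) (B : Matrix (Fin p) (Fin q) ℂ)
    (i : Fin m) (j : Fin q) : ‖(A * B) i j‖ ≤ ‖rowMat A i‖ * ‖rowMat Bᴴ j‖ := by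
  have h : (A * B) i j = (rowMat A i * (rowMat Bᴴ j)ᴴ) 0 0 := by
    simp [rowMat, Matrix.mul_apply]
  rw [h]
  refine (norm_entry_le_rowMat _ 0 0).trans ((norm_rowMat_le _ _).trans ?_)
  refine (Matrix.l2_opNorm_mul _ _).trans ?_
  rw [Matrix.l2_opNorm_conjTranspose]

/-- A row of `E * V` is a combination of rows of `V`. -/
theorem norm_rowMat_mul_le_of_rows {E : Matrix (Fin m) (Fin p) ℂ} {V : Matrix (Fin p) (Fin q) ℂ}
    {b ρ : ℝ} {i : Fin m} (hE : ∑ j, ‖E i j‖ ≤ b) (hρ : 0 ≤ ρ) (hV : ∀ j, ‖rowMat V j‖ ≤ ρ) :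
    ‖rowMat (E * V) i‖ ≤ b * ρ := by
  have h : rowMat (E * V) i = ∑ j, E i j • rowMat V j := by
    ext a k
    simp [rowMat, Matrix.mul_apply, Matrix.sum_apply]
  rw [h]
  refine (norm_sum_le _ _).trans ?_
  refine (Finset.sum_le_sum fun j _ => ?_).trans
    ((Finset.sum_mul _ _ _).symm.le.trans (mul_le_mul_of_nonneg_right hE hρ))
  rw [norm_smul]
  exact mul_le_mul_of_nonneg_left (hV j) (norm_nonneg _)

/-- The Schur test. -/
theorem norm_le_of_abs_sum_le {E : Matrix (Fin m) (Fin p) ℂ} {b : ℝ} (hb : 0 ≤ b)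
    (hrow : ∀ i, ∑ j, ‖E i j‖ ≤ b) (hcol : ∀ j, ∑ i, ‖E i j‖ ≤ b) : ‖E‖ ≤ b := by
  rw [Matrix.l2_opNorm_def]
  refine ContinuousLinearMap.opNorm_le_bound _ hb fun v => ?_
  rw [EuclideanSpace.norm_eq, EuclideanSpace.norm_eq, ← Real.sqrt_sq hb,
    ← Real.sqrt_mul (sq_nonneg b)]
  refine Real.sqrt_le_sqrt ?_
  have hrow2 : ∀ i, ‖(E *ᵥ v.ofLp) i‖ ^ 2 ≤ b * ∑ j, ‖E i j‖ * ‖v j‖ ^ 2 := by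
    intro i
    have h1 : ‖(E *ᵥ v.ofLp) i‖ ≤ ∑ j, ‖E i j‖ * ‖v j‖ := by
      rw [Matrix.mulVec, dotProduct]
      refine (norm_sum_le _ _).trans (le_of_eq ?_)
      simp
    have h2 : (∑ j, ‖E i j‖ * ‖v j‖) ^ 2 ≤ (∑ j, ‖E i j‖) * ∑ j, ‖E i j‖ * ‖v j‖ ^ 2 := by
      refine Finset.sum_sq_le_sum_mul_sum_of_sq_le_mul _ (fun j _ => norm_nonneg _)
        (fun j _ => by positivity) fun j _ => le_of_eq (by ring)
    calc ‖(E *ᵥ v.ofLp) i‖ ^ 2 ≤ (∑ j, ‖E i j‖ * ‖v j‖) ^ 2 :=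
          pow_le_pow_left₀ (norm_nonneg _) h1 2
      _ ≤ _ := h2
      _ ≤ _ := mul_le_mul_of_nonneg_right (hrow i) (Finset.sum_nonneg fun j _ => by positivity)
  calc ∑ i, ‖(E *ᵥ v.ofLp) i‖ ^ 2 ≤ ∑ i, b * ∑ j, ‖E i j‖ * ‖v j‖ ^ 2 :=
        Finset.sum_le_sum fun i _ => hrow2 i
    _ = b * ∑ j, (∑ i, ‖E i j‖) * ‖v j‖ ^ 2 := by
        rw [← Finset.mul_sum, Finset.sum_comm]
        simp only [Finset.sum_mul]
    _ ≤ b * ∑ j, b * ‖v j‖ ^ 2 := by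
        refine mul_le_mul_of_nonneg_left (Finset.sum_le_sum fun j _ => ?_) hb
        exact mul_le_mul_of_nonneg_right (hcol j) (by positivity)
    _ = b ^ 2 * ∑ j, ‖v j‖ ^ 2 := by rw [← Finset.mul_sum]; ring

theorem norm_diagonal_le {d : Fin q → ℝ} {t : ℝ} (ht : 0 ≤ t) (hd : ∀ i, |d i| ≤ t) :
    ‖(Matrix.diagonal fun i => (d i : ℂ))‖ ≤ t := by
  rw [Matrix.l2_opNorm_diagonal]
  exact (pi_norm_le_iff_of_nonneg ht).2 fun i => by simpa using hd i

theorem le_norm_diagonal_mul {d : Fin q → ℝ} {t : ℝ} (ht : 0 < t) (hd : ∀ i, t ≤ d i)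
    (Y : Matrix (Fin q) (Fin p) ℂ) :
    t * ‖Y‖ ≤ ‖(Matrix.diagonal fun i => (d i : ℂ)) * Y‖ := by
  have h : Y = (Matrix.diagonal fun i => (((d i)⁻¹ : ℝ) : ℂ)) *
      ((Matrix.diagonal fun i => (d i : ℂ)) * Y) := by
    rw [← Matrix.mul_assoc, Matrix.diagonal_mul_diagonal]
    have : (fun i => (((d i)⁻¹ : ℝ) : ℂ) * (d i : ℂ)) = fun _ => 1 := by
      funext i
      have : d i ≠ 0 := (ht.trans_le (hd i)).ne'
      rw [← Complex.ofReal_mul, inv_mul_cancel₀ this, Complex.ofReal_one]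
    rw [this, Matrix.diagonal_one, Matrix.one_mul]
  have h2 : ‖Y‖ ≤ t⁻¹ * ‖(Matrix.diagonal fun i => (d i : ℂ)) * Y‖ := by
    conv_lhs => rw [h]
    refine (Matrix.l2_opNorm_mul _ _).trans (mul_le_mul_of_nonneg_right ?_ (norm_nonneg _))
    refine norm_diagonal_le (by positivity) fun i => ?_
    rw [abs_of_nonneg (inv_nonneg.2 (ht.le.trans (hd i)))]
    exact inv_anti₀ ht (hd i)
  rw [inv_mul_eq_div, le_div_iff₀ ht] at h2
  linarith

theorem exists_col_mul_eq_zero (M : Matrix (Fin m) (Fin p) ℂ) (h : m < p) :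
    ∃ w : Matrix (Fin p) (Fin 1) ℂ, w ≠ 0 ∧ M * w = 0 := by
  obtain ⟨v, hv, hv0⟩ := Submodule.exists_mem_ne_zero_of_ne_bot
    (LinearMap.ker_ne_bot_of_finrank_lt (f := M.mulVecLin) (by simpa using h))
  refine ⟨Matrix.of fun i _ => v i, fun h0 => hv0 ?_, ?_⟩
  · funext i
    exact congrFun (congrFun h0 i) 0
  · ext i j
    have := congrFun (LinearMap.mem_ker.1 hv) i
    simpa [Matrix.mulVec, dotProduct, Matrix.mul_apply] using this

end Norms

/-! ### Singular values -/

section SingularValues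

variable {m p q r : ℕ}

/-- An orthonormal basis of right singular vectors, as the columns of a square matrix. -/
theorem exists_right_singular_basis (M : Matrix (Fin m) (Fin p) ℂ) :
    ∃ X : Matrix (Fin p) (Fin p) ℂ, Xᴴ * X = 1 ∧
      (M * X)ᴴ * (M * X) = (Matrix.diagonal fun i : Fin p => (sv M i : ℂ))ᴴ *
        Matrix.diagonal fun i : Fin p => (sv M i : ℂ) := by
  set T := Matrix.toEuclideanLin M with hT
  have hn : Module.finrank ℂ (EuclideanSpace ℂ (Fin p)) = p := finrank_euclideanSpace_fin
  set b := T.isSymmetric_adjoint_comp_self.eigenvectorBasis hn with hb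
  have hbb : ∀ i j, inner ℂ (b i) (b j) = if i = j then (1 : ℂ) else 0 :=
    orthonormal_iff_ite.1 b.orthonormal
  refine ⟨Matrix.of fun i j => b j i, ?_, ?_⟩
  · ext i j
    rw [Matrix.one_apply, ← hbb i j, PiLp.inner_apply, Matrix.mul_apply]
    refine Finset.sum_congr rfl fun k _ => ?_
    simp [mul_comm]
  · ext i j
    have h1 : ((M * Matrix.of fun i j => b j i)ᴴ * (M * Matrix.of fun i j => b j i)) i j
        = inner ℂ (T (b i)) (T (b j)) := by
      rw [PiLp.inner_apply, Matrix.mul_apply]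
      refine Finset.sum_congr rfl fun k _ => ?_
      rw [RCLike.inner_apply, mul_comm]
      rfl
    have h2 : inner ℂ (T (b i)) (T (b j))
        = ((sv M j ^ 2 : ℝ) : ℂ) * if i = j then (1 : ℂ) else 0 := by
      rw [← LinearMap.adjoint_inner_right, ← LinearMap.comp_apply, hb,
        LinearMap.IsSymmetric.apply_eigenvectorBasis, ← hb, inner_smul_right, hbb, sv, ← hT,
        T.sq_singularValues_fin hn]
      rfl
    rw [h1, h2, Matrix.diagonal_conjTranspose, Matrix.diagonal_mul_diagonal, Matrix.diagonal_apply]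
    split_ifs with h
    · subst h
      simp [sq]
    · simp

theorem sv_nonneg (M : Matrix (Fin m) (Fin p) ℂ) (i : ℕ) : 0 ≤ sv M i :=
  LinearMap.singularValues_nonneg _ i

theorem sv_antitone (M : Matrix (Fin m) (Fin p) ℂ) : Antitone (sv M) :=
  LinearMap.singularValues_antitone _

theorem sv_pos_of_lt_rank {M : Matrix (Fin m) (Fin p) ℂ} {i : ℕ} (h : i < M.rank) :
    0 < sv M i := by
  rw [sv, LinearMap.singularValues_pos_iff_lt_finrank_range]
  rwa [Matrix.rank_eq_finrank_range_toLin M (EuclideanSpace.basisFun (Fin m) ℂ).toBasis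
    (EuclideanSpace.basisFun (Fin p) ℂ).toBasis, ← Matrix.toEuclideanLin_eq_toLin_orthonormal] at h

theorem sv_zero_eq_norm (M : Matrix (Fin m) (Fin p) ℂ) : sv M 0 = ‖M‖ := by
  rcases Nat.eq_zero_or_pos p with rfl | hp
  · have h : M = 0 := Subsingleton.elim _ _
    rw [sv, LinearMap.singularValues_of_finrank_le _ (by simp), h, norm_zero]
  obtain ⟨X, hX, hMX⟩ := exists_right_singular_basis M
  have hX' : X * Xᴴ = 1 := mul_eq_one_comm.1 hX
  have h1 : ‖M * X‖ = ‖Matrix.diagonal fun i : Fin p => (sv M i : ℂ)‖ := by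
    simpa using norm_mul_eq_of_gram_eq hMX (1 : Matrix (Fin p) (Fin p) ℂ)
  apply le_antisymm
  · have h2 : ‖M * X‖ ≤ ‖M‖ := norm_mul_le_left M (norm_isometry_le hX)
    rw [h1, Matrix.l2_opNorm_diagonal] at h2
    refine le_trans ?_ ((norm_le_pi_norm _ (⟨0, hp⟩ : Fin p)).trans h2)
    simp [abs_of_nonneg (sv_nonneg M 0)]
  · have h2 : M = M * X * Xᴴ := by rw [Matrix.mul_assoc, hX', Matrix.mul_one]
    rw [h2]
    refine (norm_mul_le_left _ (norm_conjTranspose_isometry_le hX)).trans ?_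
    rw [h1, ← h2]
    refine norm_diagonal_le (sv_nonneg M 0) fun i => ?_
    rw [abs_of_nonneg (sv_nonneg M i)]
    exact sv_antitone M (Nat.zero_le i)

/-- On the span of the leading `r` right singular vectors, `M` expands by at least its `r`-th
singular value. -/
theorem exists_isometry_sv_le {M : Matrix (Fin m) (Fin p) ℂ} (hr : M.rank = r) :
    ∃ X : Matrix (Fin p) (Fin r) ℂ, Xᴴ * X = 1 ∧
      ∀ w : Matrix (Fin r) (Fin 1) ℂ, sv M (r - 1) * ‖w‖ ≤ ‖M * (X * w)‖ := by
  have hrp : r ≤ p := hr ▸ M.rank_le_width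
  obtain ⟨X, hX, hMX⟩ := exists_right_singular_basis M
  refine ⟨X.submatrix id (Fin.castLE hrp), ?_, fun w => ?_⟩
  · ext i j
    have := congrFun (congrFun hX (Fin.castLE hrp i)) (Fin.castLE hrp j)
    simpa [Matrix.mul_apply, Matrix.one_apply] using this
  · have h : (M * X.submatrix id (Fin.castLE hrp))ᴴ * (M * X.submatrix id (Fin.castLE hrp))
        = (Matrix.diagonal fun i : Fin r => (sv M i : ℂ))ᴴ *
          Matrix.diagonal fun i : Fin r => (sv M i : ℂ) := by
      ext i j
      have := congrFun (congrFun hMX (Fin.castLE hrp i)) (Fin.castLE hrp j)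
      rw [Matrix.diagonal_conjTranspose, Matrix.diagonal_mul_diagonal] at this ⊢
      simpa [Matrix.mul_apply, Matrix.diagonal_apply] using this
    rw [← Matrix.mul_assoc, norm_mul_eq_of_gram_eq h]
    rcases Nat.eq_zero_or_pos r with h0 | h0
    · subst h0
      have : w = 0 := Subsingleton.elim _ _
      simp [this]
    · exact le_norm_diagonal_mul (sv_pos_of_lt_rank (by omega))
        (fun i => sv_antitone M (by omega)) w

/-- Half of the Courant–Fischer principle: if `A` expands an `r`-dimensional space by at least
`t > 0`, then its first `r` singular values are at least `t`. -/
theorem IsSVD.le_of_expansion {A : Matrix (Fin m) (Fin p) ℂ} {U : Matrix (Fin m) (Fin q) ℂ}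
    {σ : Fin q → ℝ} {V : Matrix (Fin p) (Fin q) ℂ} (h : IsSVD A U σ V) {t : ℝ} (ht : 0 < t)
    {X : Matrix (Fin p) (Fin r) ℂ} (hX : ‖X‖ ≤ 1)
    (hA : ∀ w : Matrix (Fin r) (Fin 1) ℂ, t * ‖w‖ ≤ ‖A * (X * w)‖) :
    r ≤ q ∧ ∀ i : Fin q, i.val < r → t ≤ σ i := by
  -- A vector of the space that is orthogonal to the first `j < r` right singular vectors.
  have key : ∀ j < r, ∃ w : Matrix (Fin r) (Fin 1) ℂ, w ≠ 0 ∧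
      ∀ i : Fin q, i.val < j → (Vᴴ * (X * w)) i 0 = 0 := by
    intro j hj
    obtain ⟨w, hw, hw0⟩ := exists_col_mul_eq_zero
      (Matrix.of fun (i : Fin j) k => if hi : i.val < q then (Vᴴ * X) ⟨i, hi⟩ k else 0) hj
    refine ⟨w, hw, fun i hi => ?_⟩
    have := congrFun (congrFun hw0 ⟨i, hi⟩) 0
    rw [← Matrix.mul_assoc, Matrix.mul_apply]
    simpa [Matrix.mul_apply] using this
  have hnorm : ∀ w : Matrix (Fin r) (Fin 1) ℂ,
      ‖A * (X * w)‖ = ‖Matrix.diagonal (fun i => (σ i : ℂ)) * (Vᴴ * (X * w))‖ := by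
    intro w
    rw [h.eq_mul, Matrix.mul_assoc, Matrix.mul_assoc, norm_isometry_mul h.left_orthonormal]
  have hVX : ∀ w : Matrix (Fin r) (Fin 1) ℂ, ‖Vᴴ * (X * w)‖ ≤ ‖w‖ := fun w =>
    (norm_mul_le_right (norm_conjTranspose_isometry_le h.right_orthonormal) _).trans
      (norm_mul_le_right hX _)
  constructor
  · by_contra! hqr
    obtain ⟨w, hw, hw0⟩ := key q hqr
    have hz : Vᴴ * (X * w) = 0 := by
      ext i j
      rw [Subsingleton.elim j 0]
      exact hw0 i i.isLt
    have := hA w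
    rw [hnorm, hz, Matrix.mul_zero, norm_zero] at this
    exact absurd this (not_le.2 (mul_pos ht (norm_pos_iff.2 hw)))
  · intro j hj
    obtain ⟨w, hw, hw0⟩ := key j hj
    have hdiag : Matrix.diagonal (fun i => (σ i : ℂ)) * (Vᴴ * (X * w))
        = Matrix.diagonal (fun i => ((if i < j then 0 else σ i : ℝ) : ℂ)) * (Vᴴ * (X * w)) := by
      ext i k
      rw [Subsingleton.elim k 0, Matrix.diagonal_mul, Matrix.diagonal_mul]
      by_cases hij : i < j
      · rw [hw0 i hij, mul_zero, mul_zero]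
      · simp [hij]
    have h1 := hA w
    rw [hnorm, hdiag] at h1
    have h2 : ‖Matrix.diagonal (fun i => ((if i < j then 0 else σ i : ℝ) : ℂ))‖ ≤ σ j := by
      refine norm_diagonal_le (h.nonneg j) fun i => ?_
      split_ifs with hij
      · simpa using h.nonneg j
      · rw [abs_of_nonneg (h.nonneg i)]
        exact h.antitone (not_lt.1 hij)
    have h3 := h1.trans ((Matrix.l2_opNorm_mul _ _).trans
      (mul_le_mul h2 (hVX w) (norm_nonneg _) (h.nonneg j)))
    exact le_of_mul_le_mul_right h3 (norm_pos_iff.2 hw)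

/-- The other half of the Courant–Fischer principle: if `A` is bounded by `t` on a space of
codimension at most `r`, then its singular values after the first `r` ones are at most `t`. -/
theorem IsSVD.le_of_contraction {A : Matrix (Fin m) (Fin p) ℂ} {U : Matrix (Fin m) (Fin q) ℂ}
    {σ : Fin q → ℝ} {V : Matrix (Fin p) (Fin q) ℂ} (h : IsSVD A U σ V) {t : ℝ} (ht : 0 ≤ t)
    {Y : Matrix (Fin r) (Fin p) ℂ}
    (hA : ∀ v : Matrix (Fin p) (Fin 1) ℂ, Y * v = 0 → ‖A * v‖ ≤ t * ‖v‖)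
    (i : Fin q) (hi : r ≤ i.val) : σ i ≤ t := by
  have hrq : r + 1 ≤ q := by have := i.isLt; omega
  rcases (h.nonneg i).eq_or_lt with h0 | hpos
  · rwa [← h0]
  -- `J` embeds the first `r + 1` coordinates; some vector of their span is annihilated by `Y`.
  set J : Matrix (Fin q) (Fin (r + 1)) ℂ :=
    (1 : Matrix (Fin q) (Fin q) ℂ).submatrix id (Fin.castLE hrq) with hJ
  have hJJ : Jᴴ * J = 1 := by
    ext a b
    simp [hJ, Matrix.mul_apply, Matrix.one_apply]
  obtain ⟨w, hw, hw0⟩ := exists_col_mul_eq_zero (Y * (V * J)) (Nat.lt_succ_self r)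
  have h1 := hA (V * (J * w)) (by rw [← hw0]; simp only [Matrix.mul_assoc])
  rw [norm_isometry_mul h.right_orthonormal, norm_isometry_mul hJJ] at h1
  have h2 : A * (V * (J * w))
      = U * (J * (Matrix.diagonal (fun k : Fin (r + 1) => (σ (Fin.castLE hrq k) : ℂ)) * w)) := by
    rw [h.eq_mul, Matrix.mul_assoc (U * _), ← Matrix.mul_assoc Vᴴ, h.right_orthonormal,
      Matrix.one_mul, Matrix.mul_assoc, ← Matrix.mul_assoc _ J, ← Matrix.mul_assoc J]
    congr 2
    ext a b
    rw [Matrix.diagonal_mul, Matrix.mul_diagonal]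
    simp only [hJ, Matrix.submatrix_apply, id, Matrix.one_apply]
    split_ifs with hab
    · rw [hab, mul_comm]
    · simp
  rw [h2, norm_isometry_mul h.left_orthonormal, norm_isometry_mul hJJ] at h1
  have h3 := le_norm_diagonal_mul (d := fun k : Fin (r + 1) => σ (Fin.castLE hrq k)) hpos
    (fun k => h.antitone (Fin.le_def.2 (by
      have hk := k.isLt
      simp only [Fin.val_castLE]
      omega))) w
  exact le_of_mul_le_mul_right (h3.trans h1) (norm_pos_iff.2 hw)

theorem IsSVD.conjTranspose {A : Matrix (Fin m) (Fin p) ℂ} {U : Matrix (Fin m) (Fin q) ℂ}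
    {σ : Fin q → ℝ} {V : Matrix (Fin p) (Fin q) ℂ} (h : IsSVD A U σ V) : IsSVD Aᴴ V σ U where
  left_orthonormal := h.right_orthonormal
  right_orthonormal := h.left_orthonormal
  nonneg := h.nonneg
  antitone := h.antitone
  eq_mul := by
    rw [h.eq_mul, Matrix.conjTranspose_mul, Matrix.conjTranspose_mul,
      Matrix.conjTranspose_conjTranspose, Matrix.diagonal_conjTranspose, Matrix.mul_assoc]
    congr 3
    ext i
    simp

theorem IsSVD.proj_mul {A : Matrix (Fin m) (Fin p) ℂ} {U : Matrix (Fin m) (Fin q) ℂ}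
    {σ : Fin q → ℝ} {V : Matrix (Fin p) (Fin q) ℂ} (h : IsSVD A U σ V) : U * Uᴴ * A = A := by
  rw [h.eq_mul, Matrix.mul_assoc U, ← Matrix.mul_assoc Uᴴ, ← Matrix.mul_assoc Uᴴ,
    h.left_orthonormal, Matrix.one_mul, Matrix.mul_assoc]

theorem IsSVD.mul_proj {A : Matrix (Fin m) (Fin p) ℂ} {U : Matrix (Fin m) (Fin q) ℂ}
    {σ : Fin q → ℝ} {V : Matrix (Fin p) (Fin q) ℂ} (h : IsSVD A U σ V) : A * (V * Vᴴ) = A := by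
  rw [h.eq_mul, Matrix.mul_assoc (U * _), ← Matrix.mul_assoc Vᴴ, h.right_orthonormal,
    Matrix.one_mul]

theorem IsSVD.mul_right {A : Matrix (Fin m) (Fin p) ℂ} {U : Matrix (Fin m) (Fin q) ℂ}
    {σ : Fin q → ℝ} {V : Matrix (Fin p) (Fin q) ℂ} (h : IsSVD A U σ V) :
    A * V = U * Matrix.diagonal fun i => (σ i : ℂ) := by
  rw [h.eq_mul, Matrix.mul_assoc, h.right_orthonormal, Matrix.mul_one]

/-- A matrix of rank `r` expands its row space by at least its `r`-th singular value. -/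
theorem IsSVD.sv_le {A : Matrix (Fin m) (Fin p) ℂ} {U : Matrix (Fin m) (Fin r) ℂ}
    {σ : Fin r → ℝ} {V : Matrix (Fin p) (Fin r) ℂ} (h : IsSVD A U σ V) (hr : A.rank = r)
    (i : Fin r) : sv A (r - 1) ≤ σ i := by
  obtain ⟨X, hX, hA⟩ := exists_isometry_sv_le hr
  have := i.isLt
  exact (h.le_of_expansion (sv_pos_of_lt_rank (by omega)) (norm_isometry_le hX) hA).2 i i.isLt

theorem IsSVD.rank_eq {A : Matrix (Fin m) (Fin p) ℂ} {U : Matrix (Fin m) (Fin r) ℂ}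
    {σ : Fin r → ℝ} {V : Matrix (Fin p) (Fin r) ℂ} (h : IsSVD A U σ V) (hσ : ∀ i, 0 < σ i) :
    A.rank = r := by
  apply le_antisymm
  · rw [h.eq_mul]
    exact (Matrix.rank_mul_le_right _ _).trans
      ((Matrix.rank_le_height _))
  · have h1 : Uᴴ * A * V = Matrix.diagonal fun i => (σ i : ℂ) := by
      rw [Matrix.mul_assoc, h.mul_right, ← Matrix.mul_assoc, h.left_orthonormal, Matrix.one_mul]
    have h2 : (Matrix.diagonal fun i => (σ i : ℂ)).rank = r := by
      rw [Matrix.rank_of_isUnit, Fintype.card_fin]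
      rw [Matrix.isUnit_diagonal, Pi.isUnit_iff]
      intro i
      simpa using (hσ i).ne'
    rw [← h2, ← h1]
    exact (Matrix.rank_mul_le_left _ _).trans (Matrix.rank_mul_le_right _ _)

/-- The row norms of the left factor do not depend on the decomposition with `r` nonzero singular
values: two left factors differ by the contraction `Uᴴ * U'`. -/
theorem IsSVD.norm_rowMat_le {A : Matrix (Fin m) (Fin p) ℂ}
    {U U' : Matrix (Fin m) (Fin r) ℂ} {σ σ' : Fin r → ℝ} {V V' : Matrix (Fin p) (Fin r) ℂ}
    (h : IsSVD A U σ V) (h' : IsSVD A U' σ' V') (hσ : ∀ i, 0 < σ' i) (i : Fin m) :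
    ‖rowMat U' i‖ ≤ ‖rowMat U i‖ := by
  have h1 : U' = U * (Uᴴ * U') := by
    have h2 : U' = A * V' * Matrix.diagonal fun i => (((σ' i)⁻¹ : ℝ) : ℂ) := by
      rw [h'.mul_right, Matrix.mul_assoc, Matrix.diagonal_mul_diagonal]
      have : (fun i => (σ' i : ℂ) * (((σ' i)⁻¹ : ℝ) : ℂ)) = fun _ => 1 := by
        funext i
        rw [← Complex.ofReal_mul, mul_inv_cancel₀ (hσ i).ne', Complex.ofReal_one]
      rw [this, Matrix.diagonal_one, Matrix.mul_one]
    conv_rhs => rw [h2]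
    rw [← Matrix.mul_assoc, ← Matrix.mul_assoc, ← Matrix.mul_assoc, h.proj_mul, ← h2]
  conv_lhs => rw [h1]
  refine (norm_rowMat_mul_le _ _ _).trans (mul_le_of_le_one_right (norm_nonneg _) ?_)
  exact (norm_mul_le_right (norm_conjTranspose_isometry_le h.left_orthonormal) _).trans
    (norm_isometry_le h'.left_orthonormal)

end SingularValues

/-! ### Perturbation of the tangent space projection -/

section Tangent

variable {m p q r : ℕ}

theorem tangentProj_conjTranspose (U : Matrix (Fin m) (Fin r) ℂ) (V : Matrix (Fin p) (Fin r) ℂ)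
    (M : Matrix (Fin m) (Fin p) ℂ) : (tangentProj U V M)ᴴ = tangentProj V U Mᴴ := by
  simp only [tangentProj, Matrix.conjTranspose_add, Matrix.conjTranspose_sub,
    Matrix.conjTranspose_mul, Matrix.conjTranspose_conjTranspose, Matrix.mul_assoc]
  abel

theorem tangentProj_eq (U : Matrix (Fin m) (Fin r) ℂ) (V : Matrix (Fin p) (Fin r) ℂ)
    (M : Matrix (Fin m) (Fin p) ℂ) :
    tangentProj U V M = M - (1 - U * Uᴴ) * M * (1 - V * Vᴴ) := by
  simp only [tangentProj, Matrix.mul_sub, Matrix.sub_mul, Matrix.mul_one, Matrix.one_mul]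
  abel

theorem tangentProj_add_sub (U : Matrix (Fin m) (Fin r) ℂ) (V : Matrix (Fin p) (Fin r) ℂ)
    (L E : Matrix (Fin m) (Fin p) ℂ) :
    tangentProj U V (L + E) - L
      = U * Uᴴ * E + (1 - U * Uᴴ) * (E * (V * Vᴴ)) - (1 - U * Uᴴ) * L * (1 - V * Vᴴ) := by
  rw [tangentProj_eq]
  simp only [Matrix.mul_sub, Matrix.sub_mul, Matrix.mul_add, Matrix.add_mul, Matrix.mul_one,
    Matrix.one_mul, Matrix.mul_assoc]
  abel

theorem one_sub_proj_mul_self {U : Matrix (Fin m) (Fin r) ℂ} (hU : Uᴴ * U = 1) :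
    (1 - U * Uᴴ) * U = 0 := by
  rw [Matrix.sub_mul, Matrix.one_mul, Matrix.mul_assoc, hU, Matrix.mul_one, sub_self]

theorem conjTranspose_mul_one_sub_proj {U : Matrix (Fin m) (Fin r) ℂ} (hU : Uᴴ * U = 1) :
    Uᴴ * (1 - U * Uᴴ) = 0 := by
  rw [Matrix.mul_sub, Matrix.mul_one, ← Matrix.mul_assoc, hU, Matrix.one_mul, sub_self]

theorem one_sub_proj_conjTranspose (U : Matrix (Fin m) (Fin r) ℂ) :
    (1 - U * Uᴴ)ᴴ = 1 - U * Uᴴ := by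
  simp

theorem IsSVD.norm_mul_one_sub_proj_le {L L₀ : Matrix (Fin m) (Fin p) ℂ}
    {U : Matrix (Fin m) (Fin q) ℂ} {σ : Fin q → ℝ} {V : Matrix (Fin p) (Fin q) ℂ}
    (h : IsSVD L₀ U σ V) : ‖L * (1 - V * Vᴴ)‖ ≤ ‖L - L₀‖ := by
  have h1 : L * (1 - V * Vᴴ) = (L - L₀) * (1 - V * Vᴴ) := by
    rw [Matrix.sub_mul L, Matrix.mul_sub L₀, h.mul_proj, Matrix.mul_one, sub_self, sub_zero]
  rw [h1]
  exact norm_mul_le_left _ (norm_one_sub_proj_le h.right_orthonormal)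

theorem IsSVD.norm_one_sub_proj_mul_le {L L₀ : Matrix (Fin m) (Fin p) ℂ}
    {U : Matrix (Fin m) (Fin q) ℂ} {σ : Fin q → ℝ} {V : Matrix (Fin p) (Fin q) ℂ}
    (h : IsSVD L₀ U σ V) : ‖(1 - U * Uᴴ) * L‖ ≤ ‖L - L₀‖ := by
  have h1 : (1 - U * Uᴴ) * L = (1 - U * Uᴴ) * (L - L₀) := by
    rw [Matrix.mul_sub, Matrix.sub_mul _ _ L₀, h.proj_mul, Matrix.one_mul, sub_self, sub_zero]
  rw [h1]
  exact norm_mul_le_right (norm_one_sub_proj_le h.left_orthonormal) _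

/-- The part of `L` outside the tangent space at a nearby `L₀` is of second order. -/
theorem norm_tangent_defect_le {L L₀ : Matrix (Fin m) (Fin p) ℂ}
    {U : Matrix (Fin m) (Fin r) ℂ} {σ : Fin r → ℝ} {V : Matrix (Fin p) (Fin r) ℂ}
    {U₀ : Matrix (Fin m) (Fin q) ℂ} {σ₀ : Fin q → ℝ} {V₀ : Matrix (Fin p) (Fin q) ℂ}
    (h : IsSVD L U σ V) (h₀ : IsSVD L₀ U₀ σ₀ V₀) {s d : ℝ} (hs : 0 < s) (hσ : ∀ i, s ≤ σ i)
    (hd : ‖L - L₀‖ ≤ d) : ‖(1 - U₀ * U₀ᴴ) * L * (1 - V₀ * V₀ᴴ)‖ ≤ d ^ 2 / s := by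
  have h1 : ‖Vᴴ * (1 - V₀ * V₀ᴴ)‖ ≤ d / s := by
    rw [le_div_iff₀ hs, mul_comm]
    refine (le_norm_diagonal_mul hs hσ _).trans ?_
    rw [← norm_isometry_mul h.left_orthonormal, ← Matrix.mul_assoc, ← Matrix.mul_assoc,
      ← h.eq_mul]
    exact h₀.norm_mul_one_sub_proj_le.trans hd
  have h2 : (1 - U₀ * U₀ᴴ) * L * (1 - V₀ * V₀ᴴ)
      = ((1 - U₀ * U₀ᴴ) * L) * V * (Vᴴ * (1 - V₀ * V₀ᴴ)) := by
    conv_lhs => rw [← h.mul_proj]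
    simp only [Matrix.mul_assoc]
  have hd0 : 0 ≤ d := (norm_nonneg _).trans hd
  rw [h2]
  refine (Matrix.l2_opNorm_mul _ _).trans ?_
  calc _ ≤ d * (d / s) := mul_le_mul ((norm_mul_le_left _
          (norm_isometry_le h.right_orthonormal)).trans (h₀.norm_one_sub_proj_mul_le.trans hd))
          h1 (norm_nonneg _) hd0
    _ = d ^ 2 / s := by ring

theorem norm_tangentProj_add_sub_le {L L₀ E : Matrix (Fin m) (Fin p) ℂ}
    {U : Matrix (Fin m) (Fin r) ℂ} {σ : Fin r → ℝ} {V : Matrix (Fin p) (Fin r) ℂ}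
    {U₀ : Matrix (Fin m) (Fin q) ℂ} {σ₀ : Fin q → ℝ} {V₀ : Matrix (Fin p) (Fin q) ℂ}
    (h : IsSVD L U σ V) (h₀ : IsSVD L₀ U₀ σ₀ V₀) {s d b : ℝ} (hs : 0 < s) (hσ : ∀ i, s ≤ σ i)
    (hd : ‖L - L₀‖ ≤ d) (hE : ‖E‖ ≤ b) :
    ‖tangentProj U₀ V₀ (L + E) - L‖ ≤ 2 * b + d ^ 2 / s := by
  rw [tangentProj_add_sub]
  refine (norm_sub_le _ _).trans ((add_le_add (norm_add_le _ _)
    (norm_tangent_defect_le h h₀ hs hσ hd)).trans ?_)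
  have h1 : ‖U₀ * U₀ᴴ * E‖ ≤ b := (norm_mul_le_right (norm_proj_le h₀.left_orthonormal) _).trans hE
  have h2 : ‖(1 - U₀ * U₀ᴴ) * (E * (V₀ * V₀ᴴ))‖ ≤ b :=
    (norm_mul_le_right (norm_one_sub_proj_le h₀.left_orthonormal) _).trans
      ((norm_mul_le_left _ (norm_proj_le h₀.right_orthonormal)).trans hE)
  linarith

/-- The error of the tangent space projection has small rows: each of its terms has a factor of
one of the incoherent matrices on the left, or is sparse. -/
theorem norm_rowMat_tangentProj_add_sub_le {L L₀ E : Matrix (Fin m) (Fin p) ℂ}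
    {U : Matrix (Fin m) (Fin r) ℂ} {σ : Fin r → ℝ} {V : Matrix (Fin p) (Fin r) ℂ}
    {U₀ : Matrix (Fin m) (Fin q) ℂ} {σ₀ : Fin q → ℝ} {V₀ : Matrix (Fin p) (Fin q) ℂ}
    (h : IsSVD L U σ V) (h₀ : IsSVD L₀ U₀ σ₀ V₀) {d b ρ ρ₀ : ℝ} {i : Fin m}
    (hd : ‖L - L₀‖ ≤ d) (hE : ‖E‖ ≤ b) (hErow : ∑ j, ‖E i j‖ ≤ b)
    (hU : ‖rowMat U i‖ ≤ ρ) (hU₀ : ‖rowMat U₀ i‖ ≤ ρ₀) (hV₀ : ∀ j, ‖rowMat V₀ j‖ ≤ ρ₀) :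
    ‖rowMat (tangentProj U₀ V₀ (L + E) - L) i‖ ≤ 3 * (ρ₀ * b) + ρ * d + ρ₀ * d := by
  have hρ : 0 ≤ ρ := (norm_nonneg _).trans hU
  have hρ₀ : 0 ≤ ρ₀ := (norm_nonneg _).trans hU₀
  have hLd : ‖L * (1 - V₀ * V₀ᴴ)‖ ≤ d := h₀.norm_mul_one_sub_proj_le.trans hd
  have hU₀' := norm_conjTranspose_isometry_le h₀.left_orthonormal
  have hV₀' := norm_conjTranspose_isometry_le h₀.right_orthonormal
  have e : tangentProj U₀ V₀ (L + E) - L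
      = U₀ * (U₀ᴴ * E) + (E * V₀) * V₀ᴴ - U₀ * (U₀ᴴ * (E * (V₀ * V₀ᴴ)))
        - (U * (Uᴴ * (L * (1 - V₀ * V₀ᴴ))) - U₀ * (U₀ᴴ * (L * (1 - V₀ * V₀ᴴ)))) := by
    rw [tangentProj_add_sub, ← Matrix.mul_assoc U, ← Matrix.mul_assoc (U * Uᴴ), h.proj_mul]
    simp only [Matrix.sub_mul, Matrix.one_mul, Matrix.mul_assoc]
    abel
  have t1 : ‖rowMat (U₀ * (U₀ᴴ * E)) i‖ ≤ ρ₀ * b :=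
    (norm_rowMat_mul_le _ _ _).trans (mul_le_mul hU₀ ((norm_mul_le_right hU₀' _).trans hE)
      (norm_nonneg _) hρ₀)
  have t2 : ‖rowMat ((E * V₀) * V₀ᴴ) i‖ ≤ ρ₀ * b := by
    rw [rowMat_mul, mul_comm ρ₀]
    exact (norm_mul_le_left _ hV₀').trans (norm_rowMat_mul_le_of_rows hErow hρ₀ hV₀)
  have t3 : ‖rowMat (U₀ * (U₀ᴴ * (E * (V₀ * V₀ᴴ)))) i‖ ≤ ρ₀ * b :=
    (norm_rowMat_mul_le _ _ _).trans (mul_le_mul hU₀ ((norm_mul_le_right hU₀' _).trans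
      ((norm_mul_le_left _ (norm_proj_le h₀.right_orthonormal)).trans hE)) (norm_nonneg _) hρ₀)
  have t4 : ‖rowMat (U * (Uᴴ * (L * (1 - V₀ * V₀ᴴ)))) i‖ ≤ ρ * d :=
    (norm_rowMat_mul_le _ _ _).trans (mul_le_mul hU ((norm_mul_le_right
      (norm_conjTranspose_isometry_le h.left_orthonormal) _).trans hLd) (norm_nonneg _) hρ)
  have t5 : ‖rowMat (U₀ * (U₀ᴴ * (L * (1 - V₀ * V₀ᴴ)))) i‖ ≤ ρ₀ * d :=
    (norm_rowMat_mul_le _ _ _).trans (mul_le_mul hU₀ ((norm_mul_le_right hU₀' _).trans hLd)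
      (norm_nonneg _) hρ₀)
  rw [e, rowMat_sub, rowMat_sub, rowMat_sub, rowMat_add]
  refine (norm_sub_le _ _).trans ((add_le_add ((norm_sub_le _ _).trans
    (add_le_add_left (norm_add_le _ _) _)) (norm_sub_le _ _)).trans ?_)
  linarith

/-- If the block of `A` off `U` and off `V` vanishes, then `A` is small, of the order of the
Schur complement, on the vectors that it maps to the orthogonal complement of `U`. -/
theorem norm_mul_le_of_block_eq_zero {A : Matrix (Fin m) (Fin p) ℂ}
    {U : Matrix (Fin m) (Fin r) ℂ} {V : Matrix (Fin p) (Fin r) ℂ} {a a' s : ℝ} (hs : 0 < s)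
    (h0 : (1 - U * Uᴴ) * A * (1 - V * Vᴴ) = 0) (ha : ‖(1 - U * Uᴴ) * A * V‖ ≤ a)
    (ha' : ‖Uᴴ * A * (1 - V * Vᴴ)‖ ≤ a')
    (hA : ∀ w : Matrix (Fin r) (Fin 1) ℂ, s * ‖w‖ ≤ ‖Uᴴ * A * V * w‖)
    (v : Matrix (Fin p) (Fin 1) ℂ) (hv : Uᴴ * A * v = 0) : ‖A * v‖ ≤ a * a' / s * ‖v‖ := by
  have e1 : A * v = (1 - U * Uᴴ) * A * V * (Vᴴ * v) := by
    have h1 : (1 - U * Uᴴ) * A * v = A * v := by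
      rw [Matrix.sub_mul, Matrix.sub_mul, Matrix.one_mul, Matrix.mul_assoc U, Matrix.mul_assoc U,
        hv, Matrix.mul_zero, sub_zero]
    have h2 : (1 - U * Uᴴ) * A * v = (1 - U * Uᴴ) * A * (1 - V * Vᴴ) * v
        + (1 - U * Uᴴ) * A * V * (Vᴴ * v) := by
      rw [← Matrix.mul_assoc _ Vᴴ, ← Matrix.add_mul, Matrix.mul_assoc _ V, ← Matrix.mul_add,
        sub_add_cancel, Matrix.mul_one]
    rw [← h1, h2, h0, Matrix.zero_mul, zero_add]
  have e2 : Uᴴ * A * V * (Vᴴ * v) = -(Uᴴ * A * (1 - V * Vᴴ) * v) := by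
    rw [eq_neg_iff_add_eq_zero, ← Matrix.mul_assoc _ Vᴴ, ← Matrix.add_mul, Matrix.mul_assoc _ V,
      ← Matrix.mul_add, add_sub_cancel, Matrix.mul_one, hv]
  have h3 : ‖Vᴴ * v‖ ≤ a' / s * ‖v‖ := by
    have h4 := hA (Vᴴ * v)
    rw [e2, norm_neg] at h4
    have h5 := h4.trans ((Matrix.l2_opNorm_mul _ _).trans
      (mul_le_mul_of_nonneg_right ha' (norm_nonneg _)))
    rw [div_mul_eq_mul_div, le_div_iff₀ hs]
    linarith
  rw [e1]
  refine (Matrix.l2_opNorm_mul _ _).trans ((mul_le_mul ha h3 (norm_nonneg _)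
    ((norm_nonneg _).trans ha)).trans (le_of_eq (by ring)))

/-- `norm_mul_le_of_block_eq_zero` for a matrix of the tangent space at `L₀`. -/
theorem norm_tangentProj_mul_le {L₀ M : Matrix (Fin m) (Fin p) ℂ}
    {U₀ : Matrix (Fin m) (Fin r) ℂ} {σ₀ : Fin r → ℝ} {V₀ : Matrix (Fin p) (Fin r) ℂ}
    (h₀ : IsSVD L₀ U₀ σ₀ V₀) {s d : ℝ} (hσ₀ : ∀ i, s + d ≤ σ₀ i) (hs : 0 < s)
    (hd : ‖M - L₀‖ ≤ d) (v : Matrix (Fin p) (Fin 1) ℂ)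
    (hv : U₀ᴴ * tangentProj U₀ V₀ M * v = 0) :
    ‖tangentProj U₀ V₀ M * v‖ ≤ d * d / s * ‖v‖ := by
  have hU := conjTranspose_mul_one_sub_proj h₀.left_orthonormal
  have hV := one_sub_proj_mul_self h₀.right_orthonormal
  have hd0 : 0 ≤ d := (norm_nonneg _).trans hd
  have eU : U₀ᴴ * tangentProj U₀ V₀ M = U₀ᴴ * M := by
    rw [tangentProj_eq, Matrix.mul_sub, Matrix.mul_assoc (1 - _), ← Matrix.mul_assoc U₀ᴴ, hU,
      Matrix.zero_mul, sub_zero]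
  have eV : tangentProj U₀ V₀ M * V₀ = M * V₀ := by
    rw [tangentProj_eq, Matrix.sub_mul, Matrix.mul_assoc _ _ V₀, hV, Matrix.mul_zero, sub_zero]
  refine norm_mul_le_of_block_eq_zero (V := V₀) hs ?_ ?_ ?_ ?_ v hv
  · have h1 : ∀ {k : ℕ} {X : Matrix (Fin k) (Fin r) ℂ}, Xᴴ * X = 1 →
        (1 - X * Xᴴ) * (1 - X * Xᴴ) = 1 - X * Xᴴ := by
      intro k X hX
      rw [Matrix.mul_sub, Matrix.mul_one, ← Matrix.mul_assoc, one_sub_proj_mul_self hX,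
        Matrix.zero_mul, sub_zero]
    have h2 : (1 - U₀ * U₀ᴴ) * ((1 - U₀ * U₀ᴴ) * M * (1 - V₀ * V₀ᴴ)) * (1 - V₀ * V₀ᴴ)
        = ((1 - U₀ * U₀ᴴ) * (1 - U₀ * U₀ᴴ)) * M * ((1 - V₀ * V₀ᴴ) * (1 - V₀ * V₀ᴴ)) := by
      simp only [Matrix.mul_assoc]
    rw [tangentProj_eq, Matrix.mul_sub _ M, Matrix.sub_mul (_ * M), h2, h1 h₀.left_orthonormal,
      h1 h₀.right_orthonormal, sub_self]
  · rw [Matrix.mul_assoc, eV, ← Matrix.mul_assoc]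
    exact (norm_mul_le_left _ (norm_isometry_le h₀.right_orthonormal)).trans
      (h₀.norm_one_sub_proj_mul_le.trans hd)
  · rw [eU, Matrix.mul_assoc]
    exact (norm_mul_le_right (norm_conjTranspose_isometry_le h₀.left_orthonormal) _).trans
      (h₀.norm_mul_one_sub_proj_le.trans hd)
  · intro w
    have e : U₀ᴴ * tangentProj U₀ V₀ M * V₀ * w
        = Matrix.diagonal (fun i => (σ₀ i : ℂ)) * w - (-(U₀ᴴ * ((M - L₀) * (V₀ * w)))) := by
      have h1 : Matrix.diagonal (fun i => (σ₀ i : ℂ)) = U₀ᴴ * (L₀ * V₀) := by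
        rw [h₀.mul_right, ← Matrix.mul_assoc, h₀.left_orthonormal, Matrix.one_mul]
      rw [eU, h1, Matrix.sub_mul, Matrix.mul_sub]
      simp only [Matrix.mul_assoc]
      abel
    have h2 : ‖-(U₀ᴴ * ((M - L₀) * (V₀ * w)))‖ ≤ d * ‖w‖ := by
      rw [norm_neg]
      refine (norm_mul_le_right (norm_conjTranspose_isometry_le h₀.left_orthonormal) _).trans ?_
      refine (Matrix.l2_opNorm_mul _ _).trans ?_
      rw [norm_isometry_mul h₀.right_orthonormal]
      exact mul_le_mul_of_nonneg_right hd (norm_nonneg _)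
    have h3 := le_norm_diagonal_mul (add_pos_of_pos_of_nonneg hs hd0) hσ₀ w
    rw [e]
    have := norm_sub_norm_le (Matrix.diagonal (fun i => (σ₀ i : ℂ)) * w)
      (-(U₀ᴴ * ((M - L₀) * (V₀ * w))))
    linarith

end Tangent

/-! ### Truncation to rank `r` -/

section Truncation

variable {m p q r : ℕ}

/-- A matrix near `L` expands the row space of `L`. -/
theorem IsSVD.expansion_of_near {L A : Matrix (Fin m) (Fin p) ℂ}
    {U : Matrix (Fin m) (Fin r) ℂ} {σ : Fin r → ℝ} {V : Matrix (Fin p) (Fin r) ℂ}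
    (h : IsSVD L U σ V) {s d : ℝ} (hs : 0 < s) (hσ : ∀ i, s ≤ σ i) (hd : ‖L - A‖ ≤ d)
    (w : Matrix (Fin r) (Fin 1) ℂ) : (s - d) * ‖w‖ ≤ ‖A * (V * w)‖ := by
  have h1 : s * ‖w‖ ≤ ‖L * (V * w)‖ := by
    rw [← Matrix.mul_assoc, h.mul_right, Matrix.mul_assoc, norm_isometry_mul h.left_orthonormal]
    exact le_norm_diagonal_mul hs hσ w
  have h2 : ‖(L - A) * (V * w)‖ ≤ d * ‖w‖ := by
    refine (Matrix.l2_opNorm_mul _ _).trans ?_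
    rw [norm_isometry_mul h.right_orthonormal]
    exact mul_le_mul_of_nonneg_right hd (norm_nonneg _)
  have h3 := norm_sub_norm_le (L * (V * w)) (A * (V * w))
  rw [← Matrix.sub_mul] at h3
  linarith

/-- The leading `r` singular triples of `A`, if they have singular values at least `t > 0`,
form a singular value decomposition of the truncation `N`. -/
theorem IsTruncatedSVD.exists_isSVD {A N : Matrix (Fin m) (Fin p) ℂ} (h : IsTruncatedSVD r A N)
    {t : ℝ} (ht : 0 < t) {X : Matrix (Fin p) (Fin r) ℂ} (hX : ‖X‖ ≤ 1)
    (hA : ∀ w : Matrix (Fin r) (Fin 1) ℂ, t * ‖w‖ ≤ ‖A * (X * w)‖) :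
    ∃ (U : Matrix (Fin m) (Fin r) ℂ) (σ : Fin r → ℝ) (V : Matrix (Fin p) (Fin r) ℂ),
      IsSVD N U σ V ∧ (∀ i, t ≤ σ i) ∧ A * V = N * V ∧ Aᴴ * U = Nᴴ * U := by
  obtain ⟨q, U, σ, V, hS, rfl⟩ := h
  obtain ⟨hrq, hσ⟩ := hS.le_of_expansion ht hX hA
  set J : Matrix (Fin q) (Fin r) ℂ :=
    (1 : Matrix (Fin q) (Fin q) ℂ).submatrix id (Fin.castLE hrq) with hJ
  have hJJ : Jᴴ * J = 1 := by
    ext a b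
    simp [hJ, Matrix.mul_apply, Matrix.one_apply]
  set σ' : Fin r → ℝ := fun i => σ (Fin.castLE hrq i) with hσ'
  have hDJ : Matrix.diagonal (fun i => (σ i : ℂ)) * J
      = J * Matrix.diagonal fun i => (σ' i : ℂ) := by
    ext a b
    rw [Matrix.diagonal_mul, Matrix.mul_diagonal]
    simp only [hJ, Matrix.submatrix_apply, id, Matrix.one_apply]
    split_ifs with hab
    · rw [hab, mul_comm]
    · simp
  have htr : Matrix.diagonal (fun i : Fin q => if i.val < r then (σ i : ℂ) else 0)
      = J * Matrix.diagonal (fun i => (σ' i : ℂ)) * Jᴴ := by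
    ext a b
    rw [Matrix.mul_apply]
    simp only [hJ, hσ', Matrix.mul_diagonal, Matrix.submatrix_apply, id,
      Matrix.one_apply, Matrix.conjTranspose_apply, Matrix.diagonal_apply]
    by_cases ha : a.val < r
    · rw [Finset.sum_eq_single ⟨a.val, ha⟩]
      · have hc : Fin.castLE hrq ⟨a.val, ha⟩ = a := rfl
        by_cases hab : a = b
        · subst hab; simp [hc, ha]
        · simp [hc, hab, Ne.symm hab]
      · intro k _ hk
        rw [if_neg, zero_mul, zero_mul]
        rintro rfl
        exact hk rfl
      · simp
    · rw [Finset.sum_eq_zero]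
      · simp [ha]
      · intro k _
        rw [if_neg, zero_mul, zero_mul]
        rintro rfl
        exact ha k.isLt
  have hN : IsSVD (U * Matrix.diagonal (fun i => if i.val < r then (σ i : ℂ) else 0) * Vᴴ)
      (U * J) σ' (V * J) := by
    refine ⟨?_, ?_, fun i => hS.nonneg _, fun i j hij => hS.antitone hij, ?_⟩
    · rw [Matrix.conjTranspose_mul, Matrix.mul_assoc, ← Matrix.mul_assoc Uᴴ,
        hS.left_orthonormal, Matrix.one_mul, hJJ]
    · rw [Matrix.conjTranspose_mul, Matrix.mul_assoc, ← Matrix.mul_assoc Vᴴ,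
        hS.right_orthonormal, Matrix.one_mul, hJJ]
    · rw [htr, Matrix.conjTranspose_mul]
      simp only [Matrix.mul_assoc]
  refine ⟨U * J, σ', V * J, hN, fun i => hσ _ i.isLt, ?_, ?_⟩
  · rw [hN.mul_right, ← Matrix.mul_assoc, hS.mul_right, Matrix.mul_assoc, hDJ, Matrix.mul_assoc]
  · rw [hN.conjTranspose.mul_right, ← Matrix.mul_assoc, hS.conjTranspose.mul_right,
      Matrix.mul_assoc, hDJ, Matrix.mul_assoc]

/-- The Eckart–Young bound: the error of the truncation is the next singular value. -/
theorem IsTruncatedSVD.norm_sub_le {A N : Matrix (Fin m) (Fin p) ℂ} (h : IsTruncatedSVD r A N)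
    {t : ℝ} (ht : 0 ≤ t) {Y : Matrix (Fin r) (Fin p) ℂ}
    (hA : ∀ v : Matrix (Fin p) (Fin 1) ℂ, Y * v = 0 → ‖A * v‖ ≤ t * ‖v‖) : ‖A - N‖ ≤ t := by
  obtain ⟨q, U, σ, V, hS, rfl⟩ := h
  have e : A - U * Matrix.diagonal (fun i => if i.val < r then (σ i : ℂ) else 0) * Vᴴ
      = U * (Matrix.diagonal (fun i => ((if i.val < r then 0 else σ i : ℝ) : ℂ)) * Vᴴ) := by
    conv_lhs => rw [hS.eq_mul]
    rw [← Matrix.sub_mul, ← Matrix.mul_sub, Matrix.diagonal_sub, Matrix.mul_assoc]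
    congr 3
    ext i
    split_ifs <;> simp
  rw [e, norm_isometry_mul hS.left_orthonormal]
  refine (norm_mul_le_left _ (norm_conjTranspose_isometry_le hS.right_orthonormal)).trans ?_
  refine norm_diagonal_le ht fun i => ?_
  split_ifs with hi
  · simpa using ht
  · rw [abs_of_nonneg (hS.nonneg i)]
    exact hS.le_of_contraction ht hA i (not_lt.1 hi)

end Truncation

/-! ### Rows and entries of the truncation -/

section Rowwise

variable {m p r : ℕ}

/-- The left singular vectors `U'` of the truncation `N` of `A` inherit small rows from `L` and
`A - L`, since `U' = A V' Σ'⁻¹`. -/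
theorem norm_rowMat_left_factor_le {L A N : Matrix (Fin m) (Fin p) ℂ}
    {U U' : Matrix (Fin m) (Fin r) ℂ} {σ σ' : Fin r → ℝ} {V V' : Matrix (Fin p) (Fin r) ℂ}
    (h : IsSVD L U σ V) (h' : IsSVD N U' σ' V') {t w ω ρ : ℝ} (ht : 0 < t) (hσ' : ∀ i, t ≤ σ' i)
    (hAN : A * V' = N * V') (hW : ‖A - L‖ ≤ w) {i : Fin m} (hWi : ‖rowMat (A - L) i‖ ≤ ω)
    (hU : ‖rowMat U i‖ ≤ ρ) : ‖rowMat U' i‖ ≤ ρ * (1 + w / t) + ω / t := by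
  set Z := V' * Matrix.diagonal fun i => (((σ' i)⁻¹ : ℝ) : ℂ) with hZ
  have hw : 0 ≤ w := (norm_nonneg _).trans hW
  have hZn : ‖Z‖ ≤ 1 / t := by
    rw [hZ, norm_isometry_mul h'.right_orthonormal]
    refine norm_diagonal_le (by positivity) fun i => ?_
    rw [abs_of_nonneg (inv_nonneg.2 (ht.le.trans (hσ' i))), one_div]
    exact inv_anti₀ ht (hσ' i)
  have hAZ : A * Z = U' := by
    rw [hZ, ← Matrix.mul_assoc, hAN, h'.mul_right, Matrix.mul_assoc, Matrix.diagonal_mul_diagonal]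
    have : (fun i => (σ' i : ℂ) * (((σ' i)⁻¹ : ℝ) : ℂ)) = fun _ => 1 := by
      funext i
      rw [← Complex.ofReal_mul, mul_inv_cancel₀ (ht.trans_le (hσ' i)).ne', Complex.ofReal_one]
    rw [this, Matrix.diagonal_one, Matrix.mul_one]
  have hWZ : ‖(A - L) * Z‖ ≤ w / t :=
    (Matrix.l2_opNorm_mul _ _).trans ((mul_le_mul hW hZn (norm_nonneg _) hw).trans
      (le_of_eq (by ring)))
  have e : U' = U * (Uᴴ * (U' - (A - L) * Z)) + (A - L) * Z := by
    have h1 : U' - (A - L) * Z = L * Z := by rw [Matrix.sub_mul, hAZ, sub_sub_cancel]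
    rw [h1, ← Matrix.mul_assoc, ← Matrix.mul_assoc, h.proj_mul, ← h1, sub_add_cancel]
  rw [e, rowMat_add]
  refine (norm_add_le _ _).trans (add_le_add ?_ ?_)
  · refine (norm_rowMat_mul_le _ _ _).trans (mul_le_mul hU ?_ (norm_nonneg _)
      ((norm_nonneg _).trans hU))
    refine (norm_mul_le_right (norm_conjTranspose_isometry_le h.left_orthonormal) _).trans ?_
    exact (norm_sub_le _ _).trans (add_le_add (norm_isometry_le h'.left_orthonormal) hWZ)
  · refine (norm_rowMat_mul_le _ _ _).trans ((mul_le_mul hWi hZn (norm_nonneg _)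
      ((norm_nonneg _).trans hWi)).trans (le_of_eq (by ring)))

/-- The part of `L` outside the column space of the truncation `N` of `A` has small rows, by
`(1 - P') A = A - N = A (1 - Q')`. -/
theorem norm_rowMat_one_sub_proj_mul_le {L A N : Matrix (Fin m) (Fin p) ℂ}
    {U U' : Matrix (Fin m) (Fin r) ℂ} {σ σ' : Fin r → ℝ} {V V' : Matrix (Fin p) (Fin r) ℂ}
    (h : IsSVD L U σ V) (h' : IsSVD N U' σ' V') (hAN : A * V' = N * V')
    (hAN' : Aᴴ * U' = Nᴴ * U') {w ω ρ ρ' e : ℝ} (hW : ‖A - L‖ ≤ w) (hR : ‖A - N‖ ≤ e) {i : Fin m}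
    (hWi : ‖rowMat (A - L) i‖ ≤ ω) (hU : ‖rowMat U i‖ ≤ ρ) (hU' : ‖rowMat U' i‖ ≤ ρ') :
    ‖rowMat ((1 - U' * U'ᴴ) * L) i‖ ≤ ρ * (e + w) + 2 * ω + ρ' * w := by
  have hQ := norm_one_sub_proj_le h'.right_orthonormal
  have e1 : A * (1 - V' * V'ᴴ) = A - N := by
    rw [Matrix.mul_sub, Matrix.mul_one, ← Matrix.mul_assoc, hAN, Matrix.mul_assoc, h'.mul_proj]
  have e2 : (1 - U' * U'ᴴ) * A = A - N := by
    have h1 : U'ᴴ * A = U'ᴴ * N := by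
      simpa using congrArg Matrix.conjTranspose hAN'
    rw [Matrix.sub_mul, Matrix.one_mul, Matrix.mul_assoc, h1, ← Matrix.mul_assoc, h'.proj_mul]
  have e3 : L * (1 - V' * V'ᴴ) = (A - N) - (A - L) * (1 - V' * V'ᴴ) := by
    rw [Matrix.sub_mul A, e1]
    abel
  have e4 : (1 - U' * U'ᴴ) * L = U * (Uᴴ * ((A - N) - (A - L) * (1 - V' * V'ᴴ)))
      + (A - L) * (1 - V' * V'ᴴ) - ((A - L) - U' * (U'ᴴ * (A - L))) := by
    rw [← e3, ← Matrix.mul_assoc, ← Matrix.mul_assoc, h.proj_mul, e3, sub_add_cancel,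
      ← Matrix.mul_assoc U', ← e2, Matrix.sub_mul, Matrix.sub_mul, Matrix.mul_sub (U' * U'ᴴ),
      Matrix.one_mul, Matrix.one_mul]
    abel
  have t1 : ‖rowMat (U * (Uᴴ * ((A - N) - (A - L) * (1 - V' * V'ᴴ)))) i‖ ≤ ρ * (e + w) := by
    refine (norm_rowMat_mul_le _ _ _).trans (mul_le_mul hU ?_ (norm_nonneg _)
      ((norm_nonneg _).trans hU))
    refine (norm_mul_le_right (norm_conjTranspose_isometry_le h.left_orthonormal) _).trans ?_
    exact (norm_sub_le _ _).trans (add_le_add hR ((norm_mul_le_left _ hQ).trans hW))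
  have t2 : ‖rowMat ((A - L) * (1 - V' * V'ᴴ)) i‖ ≤ ω := by
    rw [rowMat_mul]
    exact (norm_mul_le_left _ hQ).trans hWi
  have t3 : ‖rowMat (U' * (U'ᴴ * (A - L))) i‖ ≤ ρ' * w :=
    (norm_rowMat_mul_le _ _ _).trans (mul_le_mul hU' ((norm_mul_le_right
      (norm_conjTranspose_isometry_le h'.left_orthonormal) _).trans hW) (norm_nonneg _)
      ((norm_nonneg _).trans hU'))
  rw [e4, rowMat_sub, rowMat_add, rowMat_sub]
  refine (norm_sub_le _ _).trans ((add_le_add (norm_add_le _ _) (norm_sub_le _ _)).trans ?_)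
  linarith

/-- Entrywise error of the truncation, from the splitting
`N - L = P' (A - L) Q' - (1 - P') L - P' L (1 - Q')`. -/
theorem norm_truncation_sub_entry_le {L A N : Matrix (Fin m) (Fin p) ℂ}
    {U U' : Matrix (Fin m) (Fin r) ℂ} {σ σ' : Fin r → ℝ} {V V' : Matrix (Fin p) (Fin r) ℂ}
    (h : IsSVD L U σ V) (h' : IsSVD N U' σ' V') (hAN : A * V' = N * V')
    {w ρ ρ' η : ℝ} (hW : ‖A - L‖ ≤ w) {i : Fin m} {j : Fin p} (hV : ‖rowMat V j‖ ≤ ρ)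
    (hU' : ‖rowMat U' i‖ ≤ ρ') (hV' : ‖rowMat V' j‖ ≤ ρ')
    (hη : ‖rowMat ((1 - U' * U'ᴴ) * L) i‖ ≤ η) (hη' : ‖rowMat ((1 - V' * V'ᴴ) * Lᴴ) j‖ ≤ η) :
    ‖(N - L) i j‖ ≤ ρ' * (w * ρ') + η * ρ + ρ' * η := by
  have hρ' : 0 ≤ ρ' := (norm_nonneg _).trans hU'
  have hη0 : 0 ≤ η := (norm_nonneg _).trans hη
  have hw : 0 ≤ w := (norm_nonneg _).trans hW
  have e : N - L = U' * (U'ᴴ * (A - L) * V' * V'ᴴ) - (1 - U' * U'ᴴ) * L * (V * Vᴴ)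
      - U' * (U'ᴴ * L * (1 - V' * V'ᴴ)) := by
    have h1 : U' * (U'ᴴ * A * V' * V'ᴴ) = N := by
      rw [Matrix.mul_assoc U'ᴴ, hAN, Matrix.mul_assoc U'ᴴ, Matrix.mul_assoc N, h'.mul_proj,
        ← Matrix.mul_assoc, h'.proj_mul]
    have h2 : (1 - U' * U'ᴴ) * L * (V * Vᴴ) = (1 - U' * U'ᴴ) * L := by
      rw [Matrix.mul_assoc, h.mul_proj]
    rw [h2]
    simp only [Matrix.sub_mul, Matrix.mul_sub, Matrix.one_mul, Matrix.mul_one]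
    rw [h1]
    simp only [Matrix.mul_assoc]
    abel
  have t1 : ‖(U' * (U'ᴴ * (A - L) * V' * V'ᴴ)) i j‖ ≤ ρ' * (w * ρ') := by
    refine (norm_mul_entry_le _ _ _ _).trans (mul_le_mul hU' ?_ (norm_nonneg _) hρ')
    rw [Matrix.conjTranspose_mul, Matrix.conjTranspose_conjTranspose, mul_comm w]
    refine (norm_rowMat_mul_le _ _ _).trans (mul_le_mul hV' ?_ (norm_nonneg _) hρ')
    rw [Matrix.l2_opNorm_conjTranspose]
    exact (norm_mul_le_left _ (norm_isometry_le h'.right_orthonormal)).trans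
      ((norm_mul_le_right (norm_conjTranspose_isometry_le h'.left_orthonormal) _).trans hW)
  have t2 : ‖((1 - U' * U'ᴴ) * L * (V * Vᴴ) : Matrix _ _ ℂ) i j‖ ≤ η * ρ := by
    refine (norm_mul_entry_le _ _ _ _).trans (mul_le_mul hη ?_ (norm_nonneg _) hη0)
    rw [Matrix.conjTranspose_mul, Matrix.conjTranspose_conjTranspose, rowMat_mul]
    exact (norm_mul_le_left _ (norm_conjTranspose_isometry_le h.right_orthonormal)).trans hV
  have t3 : ‖(U' * (U'ᴴ * L * (1 - V' * V'ᴴ)) : Matrix _ _ ℂ) i j‖ ≤ ρ' * η := by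
    refine (norm_mul_entry_le _ _ _ _).trans (mul_le_mul hU' ?_ (norm_nonneg _) hρ')
    rw [Matrix.conjTranspose_mul, Matrix.conjTranspose_mul, Matrix.conjTranspose_conjTranspose,
      one_sub_proj_conjTranspose, ← Matrix.mul_assoc, rowMat_mul]
    exact (norm_mul_le_left _ (norm_isometry_le h'.left_orthonormal)).trans hη'
  rw [e, Matrix.sub_apply, Matrix.sub_apply]
  exact (norm_sub_le _ _).trans (add_le_add ((norm_sub_le _ _).trans (add_le_add t1 t2)) t3)

/-- One projection step. The scale `δ` is that of the current error `‖L - L₀‖`, and `κ * δ` is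
small compared with the least singular value `s` of `L`. The spectral error of the new matrix `N`
is at most `0.52 * δ`, its leading part `δ / 2` coming from the two terms `P E` and
`(1 - P) E Q` of the projection of `E`. -/
theorem truncation_step {L L₀ E N : Matrix (Fin m) (Fin p) ℂ}
    {U : Matrix (Fin m) (Fin r) ℂ} {σ : Fin r → ℝ} {V : Matrix (Fin p) (Fin r) ℂ}
    {U₀ : Matrix (Fin m) (Fin r) ℂ} {σ₀ : Fin r → ℝ} {V₀ : Matrix (Fin p) (Fin r) ℂ}
    (h : IsSVD L U σ V) (h₀ : IsSVD L₀ U₀ σ₀ V₀)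
    (hN : IsTruncatedSVD r (tangentProj U₀ V₀ (L + E)) N)
    {s d b ρ ρ₀ δ κ : ℝ} (hs : 0 < s) (hσ : ∀ i, s ≤ σ i) (hρ : 0 ≤ ρ)
    (hU : ∀ i, ‖rowMat U i‖ ≤ ρ) (hV : ∀ i, ‖rowMat V i‖ ≤ ρ)
    (hU₀ : ∀ i, ‖rowMat U₀ i‖ ≤ ρ₀) (hV₀ : ∀ i, ‖rowMat V₀ i‖ ≤ ρ₀)
    (hd : ‖L - L₀‖ ≤ d) (hb : 0 ≤ b) (hrow : ∀ i, ∑ j, ‖E i j‖ ≤ b)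
    (hcol : ∀ j, ∑ i, ‖E i j‖ ≤ b) (hδ : 0 < δ) (hκ : 1 ≤ κ) (hδs : 2500 * (κ * δ) ≤ s)
    (hbδ : b ≤ δ / 4) (hdδ : d ≤ 2 * δ) (hρb : ρ₀ * b ≤ δ * ρ / 2)
    (hρd : ρ₀ * d ≤ 4 * (κ * δ * ρ)) :
    ‖L - N‖ ≤ 0.52 * δ ∧ (∀ i j, ‖(L - N) i j‖ ≤ 54 * (κ * δ * ρ ^ 2)) ∧
      ∃ (U' : Matrix (Fin m) (Fin r) ℂ) (σ' : Fin r → ℝ) (V' : Matrix (Fin p) (Fin r) ℂ),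
        IsSVD N U' σ' V' ∧ (∀ i, 0 < σ' i) ∧ (∀ i, ‖rowMat U' i‖ ≤ 2 * ρ) ∧
          ∀ i, ‖rowMat V' i‖ ≤ 2 * ρ := by
  set A := tangentProj U₀ V₀ (L + E) with hA
  have hd0 : 0 ≤ d := (norm_nonneg _).trans hd
  have hδκ : δ ≤ κ * δ := le_mul_of_one_le_left hδ.le hκ
  have hδs' : 2500 * δ ≤ s := by linarith
  have hE : ‖E‖ ≤ b := norm_le_of_abs_sum_le hb hrow hcol
  have hδρ : δ * ρ ≤ κ * δ * ρ := mul_le_mul_of_nonneg_right hδκ hρ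
  -- Spectral and row bounds for the error `A - L`.
  have hW : ‖A - L‖ ≤ 0.51 * δ := by
    refine (norm_tangentProj_add_sub_le h h₀ hs hσ hd hE).trans ?_
    have : d ^ 2 / s ≤ 0.01 * δ := by
      rw [div_le_iff₀ hs]
      nlinarith
    linarith
  have hω : 3 * (ρ₀ * b) + ρ * d + ρ₀ * d ≤ 7.5 * (κ * δ * ρ) := by nlinarith
  have hWrow : ∀ i, ‖rowMat (A - L) i‖ ≤ 7.5 * (κ * δ * ρ) := fun i =>
    (norm_rowMat_tangentProj_add_sub_le h h₀ hd hE (hrow i) (hU i) (hU₀ i) hV₀).trans hω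
  have hAt : Aᴴ - Lᴴ = tangentProj V₀ U₀ (Lᴴ + Eᴴ) - Lᴴ := by
    rw [hA, tangentProj_conjTranspose, Matrix.conjTranspose_add]
  have hWcol : ∀ j, ‖rowMat (Aᴴ - Lᴴ) j‖ ≤ 7.5 * (κ * δ * ρ) := by
    intro j
    rw [hAt]
    refine (norm_rowMat_tangentProj_add_sub_le h.conjTranspose h₀.conjTranspose (d := d) (b := b)
      ?_ ?_ ?_ (hV j) (hV₀ j) hU₀).trans hω
    · rwa [← Matrix.conjTranspose_sub, Matrix.l2_opNorm_conjTranspose]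
    · rwa [Matrix.l2_opNorm_conjTranspose]
    · simpa using hcol j
  have hWt : ‖Aᴴ - Lᴴ‖ ≤ 0.51 * δ := by
    rwa [← Matrix.conjTranspose_sub, Matrix.l2_opNorm_conjTranspose]
  -- The leading singular triples of `A`.
  obtain ⟨U', σ', V', h', hσ', hAV, hAU⟩ := hN.exists_isSVD (t := s / 2) (by positivity)
    (norm_isometry_le h.right_orthonormal) fun w => by
      refine le_trans (mul_le_mul_of_nonneg_right ?_ (norm_nonneg _))
        (h.expansion_of_near hs hσ (d := 0.51 * δ) (by rwa [norm_sub_rev]) w)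
      linarith
  -- The remainder of the truncation is of second order; `σ₀` is bounded below by that of `L`.
  have hR : ‖A - N‖ ≤ 0.005 * δ := by
    have hσ₀ : ∀ i, s / 2 + (d + b) ≤ σ₀ i := by
      intro i
      have := (h₀.le_of_expansion (t := s - d) (by linarith)
        (norm_isometry_le h.right_orthonormal) (h.expansion_of_near hs hσ hd)).2 i i.isLt
      linarith
    have hM : ‖L + E - L₀‖ ≤ d + b := by
      rw [add_sub_right_comm]
      exact (norm_add_le _ _).trans (add_le_add hd hE)
    refine (hN.norm_sub_le (t := (d + b) * (d + b) / (s / 2)) (by positivity)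
      (norm_tangentProj_mul_le h₀ hσ₀ (by positivity) hM)).trans ?_
    rw [div_le_iff₀ (by positivity)]
    have h1 : d + b ≤ 2.25 * δ := by linarith
    have h2 : (d + b) * (d + b) ≤ 2.25 * δ * (2.25 * δ) :=
      mul_le_mul h1 h1 (by positivity) (by positivity)
    nlinarith
  have hρ' : ρ * (1 + 0.51 * δ / (s / 2)) + 7.5 * (κ * δ * ρ) / (s / 2) ≤ 2 * ρ := by
    have h1 : 0.51 * δ / (s / 2) ≤ 0.01 := by
      rw [div_le_iff₀ (by positivity)]
      linarith
    have h2 : 7.5 * (κ * δ * ρ) / (s / 2) ≤ 0.01 * ρ := by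
      rw [div_le_iff₀ (by positivity)]
      nlinarith
    nlinarith
  have hU' : ∀ i, ‖rowMat U' i‖ ≤ 2 * ρ := fun i =>
    (norm_rowMat_left_factor_le h h' (by positivity) hσ' hAV hW (hWrow i) (hU i)).trans hρ'
  have hV' : ∀ i, ‖rowMat V' i‖ ≤ 2 * ρ := fun i =>
    (norm_rowMat_left_factor_le h.conjTranspose h'.conjTranspose (by positivity) hσ' hAU hWt
      (hWcol i) (hV i)).trans hρ'
  have hη0 : ρ * (0.005 * δ + 0.51 * δ) + 2 * (7.5 * (κ * δ * ρ)) + 2 * ρ * (0.51 * δ)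
      ≤ 17 * (κ * δ * ρ) := by nlinarith
  have hη : ∀ i, ‖rowMat ((1 - U' * U'ᴴ) * L) i‖ ≤ 17 * (κ * δ * ρ) := fun i =>
    (norm_rowMat_one_sub_proj_mul_le h h' hAV hAU hW hR (hWrow i) (hU i) (hU' i)).trans hη0
  have hη' : ∀ j, ‖rowMat ((1 - V' * V'ᴴ) * Lᴴ) j‖ ≤ 17 * (κ * δ * ρ) := fun j =>
    (norm_rowMat_one_sub_proj_mul_le h.conjTranspose h'.conjTranspose hAU (by simpa using hAV) hWt
      (by rwa [← Matrix.conjTranspose_sub, Matrix.l2_opNorm_conjTranspose]) (hWcol j) (hV j)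
      (hV' j)).trans hη0
  refine ⟨?_, fun i j => ?_, U', σ', V', h', fun i => (half_pos hs).trans_le (hσ' i), hU', hV'⟩
  · have e : L - N = (A - N) - (A - L) := by abel
    rw [e]
    refine (norm_sub_le _ _).trans ((add_le_add hR hW).trans ?_)
    linarith
  · have h1 := norm_truncation_sub_entry_le h h' hAV hW (hV j) (hU' i) (hV' j) (hη i) (hη' j)
    rw [← norm_neg, ← Matrix.neg_apply, neg_sub]
    refine h1.trans ?_
    have h2 : δ * ρ * ρ ≤ κ * δ * ρ * ρ := mul_le_mul_of_nonneg_right hδρ hρ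
    nlinarith

end Rowwise

/-! ### Hankel matrices and sparse corruptions -/

section Hankel

variable {n : ℕ}

theorem antidiag_nonempty (t : Fin n) : (antidiag t).Nonempty := by
  have ht := t.isLt
  refine ⟨(⟨min t.val (rows n - 1), ?_⟩, ⟨t.val - min t.val (rows n - 1), ?_⟩), ?_⟩
  · simp only [rows]
    omega
  · simp only [rows, cols]
    omega
  · simp only [antidiag, Finset.mem_filter, Finset.mem_univ, true_and]
    omega

/-- Averaging over the anti-diagonals does not increase the largest entry. -/
theorem norm_sub_hankelInv_le {x : Fin n → ℂ} {M : Matrix (Fin (rows n)) (Fin (cols n)) ℂ} {b : ℝ}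
    (hb : 0 ≤ b) (h : ∀ i j, ‖(hankel x - M) i j‖ ≤ b) : ‖x - hankelInv M‖ ≤ b := by
  refine (pi_norm_le_iff_of_nonneg hb).2 fun t => ?_
  have hc : (0 : ℝ) < (antidiag t).card := by
    exact_mod_cast (antidiag_nonempty t).card_pos
  have hc' : ((antidiag t).card : ℂ) ≠ 0 := by
    exact_mod_cast (antidiag_nonempty t).card_pos.ne'
  have e : (x - hankelInv M) t
      = (1 / ((antidiag t).card : ℂ)) * ∑ p ∈ antidiag t, (hankel x - M) p.1 p.2 := by
    have h1 : ∑ p ∈ antidiag t, hankel x p.1 p.2 = (antidiag t).card * x t := by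
      rw [← nsmul_eq_mul]
      refine Finset.sum_eq_card_nsmul fun p hp => ?_
      simp only [antidiag, Finset.mem_filter, Finset.mem_univ, true_and] at hp
      simp only [hankel, Matrix.of_apply]
      congr 1
      exact Fin.ext hp
    simp only [Matrix.sub_apply, Finset.sum_sub_distrib, mul_sub, h1]
    rw [← mul_assoc, one_div, inv_mul_cancel₀ hc', one_mul]
    simp [hankelInv]
  rw [e, norm_mul, norm_div, norm_one, Complex.norm_natCast, one_div, inv_mul_le_iff₀ hc]
  refine (norm_sum_le _ _).trans ?_
  rw [← nsmul_eq_mul]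
  exact Finset.sum_le_card_nsmul _ _ _ fun p _ => h p.1 p.2

theorem sum_comp_le_of_injective {ι ι' : Type*} [Fintype ι] [Fintype ι'] {f : ι' → ℝ}
    (hf : ∀ t, 0 ≤ f t) {φ : ι → ι'} (hφ : Function.Injective φ) : ∑ i, f (φ i) ≤ ∑ t, f t := by
  classical
  rw [← Finset.sum_image (f := f) (g := φ) (fun _ _ _ _ h => hφ h)]
  exact Finset.sum_le_univ_sum_of_nonneg hf

theorem sum_norm_hankel_row_le (e : Fin n → ℂ) (i : Fin (rows n)) :
    ∑ j, ‖hankel e i j‖ ≤ ∑ t, ‖e t‖ :=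
  sum_comp_le_of_injective (f := fun t => ‖e t‖) (fun _ => norm_nonneg _)
    (φ := fun j : Fin (cols n) => ⟨i.val + j.val, by
      have := i.isLt
      have := j.isLt
      simp only [rows, cols] at *
      omega⟩) fun j k h => by
      simp only [Fin.mk.injEq] at h
      exact Fin.ext (by omega)

theorem sum_norm_hankel_col_le (e : Fin n → ℂ) (j : Fin (cols n)) :
    ∑ i, ‖hankel e i j‖ ≤ ∑ t, ‖e t‖ :=
  sum_comp_le_of_injective (f := fun t => ‖e t‖) (fun _ => norm_nonneg _)
    (φ := fun i : Fin (rows n) => ⟨i.val + j.val, by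
      have := i.isLt
      have := j.isLt
      simp only [rows, cols] at *
      omega⟩) fun i k h => by
      simp only [Fin.mk.injEq] at h
      exact Fin.ext (by omega)

theorem hankel_add (x y : Fin n → ℂ) : hankel (x + y) = hankel x + hankel y := rfl

/-- If the threshold `ζ` is at least the error of `x'`, then the thresholded residual has no
entries outside the support of `s`, and its error on the support is at most `ζ + e`. -/
theorem sum_norm_sub_hardThreshold_le {x s x' : Fin n → ℂ} {e ζ : ℝ} (hx : ‖x - x'‖ ≤ e)
    (hζ : e ≤ ζ) :
    ∑ t, ‖(s - hardThreshold ζ (x + s - x')) t‖ ≤ hammingNorm s * (ζ + e) := by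
  have hxt : ∀ t, ‖x t - x' t‖ ≤ e := fun t => (norm_le_pi_norm (x - x') t).trans hx
  have he : 0 ≤ e := (norm_nonneg _).trans hx
  have h : ∀ t, ‖(s - hardThreshold ζ (x + s - x')) t‖ ≤ if s t ≠ 0 then ζ + e else 0 := by
    intro t
    simp only [hardThreshold, Pi.sub_apply, Pi.add_apply]
    have e1 : x t + s t - x' t = s t + (x t - x' t) := by ring
    rw [e1]
    by_cases hs : s t = 0
    · rw [hs, zero_add, if_neg (not_lt.2 ((hxt t).trans hζ))]
      simp
    · rw [if_pos hs]
      split_ifs with hc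
      · rw [sub_add_cancel_left, norm_neg]
        exact (hxt t).trans (by linarith)
      · have h1 := norm_sub_le (s t + (x t - x' t)) (x t - x' t)
        rw [add_sub_cancel_right] at h1
        rw [sub_zero]
        linarith [hxt t, not_lt.1 hc]
  refine (Finset.sum_le_sum fun t _ => h t).trans (le_of_eq ?_)
  rw [← Finset.sum_filter, Finset.sum_const, nsmul_eq_mul, hammingNorm]

/-- The rows of `U` cannot all be shorter than their quadratic mean. -/
theorem one_le_mul_of_rowNormLE {m r : ℕ} {U : Matrix (Fin m) (Fin r) ℂ} (hU : Uᴴ * U = 1)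
    (hr : 0 < r) {a : ℝ} (h : RowNormLE U (Real.sqrt a)) : 1 ≤ a * m := by
  have h1 : ∑ i, ∑ j, ‖U i j‖ ^ 2 = r := by
    rw [Finset.sum_comm]
    have : ∀ j, ∑ i, ‖U i j‖ ^ 2 = 1 := by
      intro j
      have h2 := congrFun (congrFun hU j) j
      rw [Matrix.mul_apply, Matrix.one_apply_eq] at h2
      have h3 : ((∑ i, ‖U i j‖ ^ 2 : ℝ) : ℂ) = 1 := by
        rw [← h2]
        push_cast
        refine Finset.sum_congr rfl fun i _ => ?_
        rw [Matrix.conjTranspose_apply, RCLike.star_def, ← Complex.normSq_eq_conj_mul_self,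
          Complex.normSq_eq_norm_sq, Complex.ofReal_pow]
      exact_mod_cast h3
    simp [this]
  have hr' : (1 : ℝ) ≤ r := by exact_mod_cast hr
  have h2 : ∑ i, ∑ j, ‖U i j‖ ^ 2 ≤ m * Real.sqrt a ^ 2 := by
    refine (Finset.sum_le_sum fun i _ => ?_).trans (by simp : ∑ _i : Fin m, Real.sqrt a ^ 2 ≤ _)
    rw [← norm_rowMat_sq]
    exact pow_le_pow_left₀ (norm_nonneg _) (rowNormLE_iff.1 h i) 2
  rcases le_total 0 a with ha | ha
  · rw [Real.sq_sqrt ha] at h2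
    linarith
  · rw [Real.sqrt_eq_zero_of_nonpos ha] at h2
    simp only [ne_eq, OfNat.ofNat_ne_zero, not_false_eq_true, zero_pow, mul_zero] at h2
    linarith

end Hankel

/-! ### Linear convergence -/

section Convergence

variable {n r : ℕ}

/-- One iteration, with the error bounds of the theorem written in terms of `q = μ c_s r / n`:
the radius `(τ - 2 τ²) / (8 α κ n)` is `(1 - 2 τ) q / 2`, and `β` is `q / (2 κ)`. -/
theorem isStep_contraction {x s x₀ s' x' : Fin n → ℂ} {q α β γ τ κ σ : ℝ} {k : ℕ}
    {L₀ L' : Matrix (Fin (rows n)) (Fin (cols n)) ℂ}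
    {U : Matrix (Fin (rows n)) (Fin r) ℂ} {σL : Fin r → ℝ} {V : Matrix (Fin (cols n)) (Fin r) ℂ}
    (h : IsSVD (hankel x) U σL V) (hr : 0 < r) (hσ : 0 < σ) (hσL : ∀ i, σ ≤ σL i)
    (hU : ∀ i, ‖rowMat U i‖ ≤ Real.sqrt q) (hV : ∀ i, ‖rowMat V i‖ ≤ Real.sqrt q)
    (hq : 0 < q) (hα : 0 < α) (hs : IsSparse α s) (hκ : 1 ≤ κ) (hL : ‖hankel x‖ = κ * σ)
    (hβ : β = q / (2 * κ)) (hγ : 0.28 ≤ γ) (hγ1 : γ ≤ 1) (hτ : τ = 4 * α * (q * n) * κ)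
    (hn : 0 < n) (hτκ : 2500 * (κ * τ) ≤ 1)
    (hd : ‖hankel x - L₀‖ ≤ 2 * τ * γ ^ k * σ)
    (hx : ‖x - x₀‖ ≤ (1 - 2 * τ) * q / 2 * γ ^ k * σ) (hr₀ : L₀.rank = r)
    {U₀ : Matrix (Fin (rows n)) (Fin r) ℂ} {σ₀ : Fin r → ℝ} {V₀ : Matrix (Fin (cols n)) (Fin r) ℂ}
    (h₀ : IsSVD L₀ U₀ σ₀ V₀) (hU₀ : ∀ i, ‖rowMat U₀ i‖ ≤ 2 * κ * Real.sqrt q)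
    (hV₀ : ∀ i, ‖rowMat V₀ i‖ ≤ 2 * κ * Real.sqrt q)
    (hstep : IsStep (x + s) r β γ k L₀ x₀ s' L' x') :
    ‖hankel x - L'‖ ≤ 2 * τ * γ ^ (k + 1) * σ ∧
      ‖x - x'‖ ≤ (1 - 2 * τ) * q / 2 * γ ^ (k + 1) * σ ∧ L'.rank = r ∧
      ∃ (U' : Matrix (Fin (rows n)) (Fin r) ℂ) (σ' : Fin r → ℝ)
        (V' : Matrix (Fin (cols n)) (Fin r) ℂ), IsSVD L' U' σ' V' ∧
          (∀ i, ‖rowMat U' i‖ ≤ 2 * Real.sqrt q) ∧ ∀ i, ‖rowMat V' i‖ ≤ 2 * Real.sqrt q := by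
  obtain ⟨hs', ⟨U₁, σ₁, V₁, h₁, htr⟩, rfl⟩ := hstep
  set g := γ ^ k with hg
  have hγ0 : 0 < γ := by linarith
  have hg0 : 0 < g := pow_pos hγ0 k
  have hg1 : g ≤ 1 := pow_le_one₀ hγ0.le hγ1
  have hκ0 : 0 < κ := by linarith
  have hn0 : (0 : ℝ) < n := by exact_mod_cast hn
  have hτ0 : 0 < τ := by rw [hτ]; positivity
  have hgσ : 0 < g * σ := mul_pos hg0 hσ
  have hττ : τ ≤ κ * τ := le_mul_of_one_le_left hτ0.le hκ
  set δ := τ * (g * σ) with hδ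
  have hδ0 : 0 < δ := mul_pos hτ0 hgσ
  -- The threshold lies between the error of `x₀` and a comparable upper bound.
  have hdκ : 2 * τ * g * σ ≤ 2 * τ * (κ * σ) := by
    have : g * σ ≤ κ * σ := mul_le_mul_of_nonneg_right (hg1.trans hκ) hσ.le
    nlinarith
  have hL₀l : κ * σ * (1 - 2 * τ) ≤ ‖L₀‖ := by
    have := norm_sub_norm_le (hankel x) L₀
    rw [hL] at this
    linarith
  have hL₀u : ‖L₀‖ ≤ κ * σ * (1 + 2 * τ) := by
    have := norm_sub_norm_le L₀ (hankel x)
    rw [hL, norm_sub_rev] at this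
    linarith
  set ζ := β * g * sv L₀ 0 with hζ
  have hβκ : β * κ = q / 2 := by rw [hβ]; field_simp
  have hβ0 : 0 < β := by rw [hβ]; positivity
  have hζl : (1 - 2 * τ) * q / 2 * g * σ ≤ ζ := by
    calc (1 - 2 * τ) * q / 2 * g * σ = β * g * (κ * σ * (1 - 2 * τ)) := by
          linear_combination (-(1 - 2 * τ) * g * σ) * hβκ
      _ ≤ ζ := by
          rw [hζ, sv_zero_eq_norm]
          exact mul_le_mul_of_nonneg_left hL₀l (by positivity)
  have hζu : ζ ≤ (1 + 2 * τ) * q / 2 * g * σ := by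
    calc ζ ≤ β * g * (κ * σ * (1 + 2 * τ)) := by
          rw [hζ, sv_zero_eq_norm]
          exact mul_le_mul_of_nonneg_left hL₀u (by positivity)
      _ = (1 + 2 * τ) * q / 2 * g * σ := by
          linear_combination ((1 + 2 * τ) * g * σ) * hβκ
  -- The error of the new estimate of the corruption.
  set b := δ / (4 * κ) with hb
  have hb0 : 0 < b := by positivity
  have hsum : ∑ t, ‖(s - s') t‖ ≤ b := by
    rw [hs']
    refine (sum_norm_sub_hardThreshold_le hx hζl).trans ?_
    calc (hammingNorm s : ℝ) * (ζ + (1 - 2 * τ) * q / 2 * g * σ)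
        ≤ (α * n) * (q * g * σ) := by
          refine mul_le_mul hs (by linarith) ?_ (by positivity)
          exact add_nonneg (mul_nonneg (by positivity) (sv_nonneg _ _))
            ((norm_nonneg _).trans hx)
      _ = b := by
          rw [hb, hδ, hτ]
          field_simp
  have hσ₁ : ∀ i, 0 < σ₁ i := by
    intro i
    have hi := i.isLt
    exact (sv_pos_of_lt_rank (by omega)).trans_le (h₁.sv_le hr₀ i)
  have hz : hankel (x + s - s') = hankel x + hankel (s - s') := by
    rw [add_sub_assoc, hankel_add]
  rw [hz] at htr
  obtain ⟨c1, c2, U', σ', V', h', hσ', hU', hV'⟩ := truncation_step h h₁ htr (d := 2 * δ) (b := b)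
    (ρ := Real.sqrt q) (ρ₀ := 2 * κ * Real.sqrt q) (δ := δ) (κ := κ) hσ hσL (Real.sqrt_nonneg q)
    hU hV (fun i => (h₀.norm_rowMat_le h₁ hσ₁ i).trans (hU₀ i))
    (fun i => (h₀.conjTranspose.norm_rowMat_le h₁.conjTranspose hσ₁ i).trans (hV₀ i))
    (hd.trans (le_of_eq (by rw [hδ]; ring))) hb0.le
    (fun i => (sum_norm_hankel_row_le _ i).trans hsum)
    (fun j => (sum_norm_hankel_col_le _ j).trans hsum) hδ0 hκ
    (by
      have h1 : 2500 * (κ * τ) * (g * σ) ≤ 1 * (1 * σ) :=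
        mul_le_mul hτκ (mul_le_mul_of_nonneg_right hg1 hσ.le) hgσ.le zero_le_one
      rw [hδ]
      linarith)
    (by
      rw [hb]
      exact div_le_div_of_nonneg_left hδ0.le (by norm_num) (by linarith))
    le_rfl (le_of_eq (by rw [hb]; field_simp; ring)) (le_of_eq (by ring))
  refine ⟨c1.trans ?_, ?_, h'.rank_eq hσ', U', σ', V', h', hU', hV'⟩
  · have e : 2 * τ * γ ^ (k + 1) * σ = 2 * γ * δ := by rw [hδ, hg, pow_succ]; ring
    rw [e]
    nlinarith
  · have e : (1 - 2 * τ) * q / 2 * γ ^ (k + 1) * σ = (1 - 2 * τ) / 2 * γ * (q * (g * σ)) := by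
      rw [hg, pow_succ]; ring
    have hqg : 0 < q * (g * σ) := mul_pos hq hgσ
    have hc : 54 * (κ * τ) ≤ (1 - 2 * τ) / 2 * γ := by nlinarith
    rw [e]
    refine norm_sub_hankelInv_le (by nlinarith) fun i j => (c2 i j).trans ?_
    rw [Real.sq_sqrt hq.le, hδ]
    calc 54 * (κ * (τ * (g * σ)) * q) = 54 * (κ * τ) * (q * (g * σ)) := by ring
      _ ≤ _ := mul_le_mul_of_nonneg_right hc hqg.le

end Convergence

end ASAP

theorem theorem1 :
    ∃ c : ℝ, 0 < c ∧
      ∀ (n r : ℕ) (_ : 0 < r) (x s : Fin n → ℂ) (μ α β γ τ κ σr : ℝ)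
        (_ : κ = ASAP.cond r (ASAP.hankel x))
        (_ : σr = ASAP.sv (ASAP.hankel x) (r - 1))
        (_ : ASAP.IsIncoherent r μ (ASAP.hankel x))
        (_ : 0 < α) (_ : ASAP.IsSparse α s)
        (_ : α ≤ c * (1 / (μ * ASAP.cs n * r * κ) ^ 2))
        (_ : β = μ * ASAP.cs n * r / (2 * κ * n))
        (_ : γ ∈ Set.Ioo (1 / Real.sqrt 12) 1)
        (_ : τ = 4 * α * μ * ASAP.cs n * r * κ)
        (K : ℕ) (Lk : ℕ → Matrix (Fin (ASAP.rows n)) (Fin (ASAP.cols n)) ℂ)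
        (xk sk : ℕ → Fin n → ℂ)
        (_ : ‖ASAP.hankel x - Lk 0‖ ≤ 2 * τ * σr)
        (_ : ‖x - xk 0‖ ≤ (τ - 2 * τ ^ 2) / (8 * α * κ * n) * σr)
        (_ : ASAP.IsIncoherent r (4 * μ * κ ^ 2) (Lk 0))
        (_ : ASAP.IsRun (x + s) r β γ K Lk xk sk),
        ∀ k ≤ K,
          ‖ASAP.hankel x - Lk k‖ ≤ 2 * τ * γ ^ k * σr ∧
          ‖x - xk k‖ ≤ (τ - 2 * τ ^ 2) / (8 * α * κ * n) * γ ^ k * σr ∧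
          ASAP.IsIncoherent r (4 * μ * κ ^ 2) (Lk k) := by
  -- With `μ c_s r ≥ 1` this value gives `κ τ ≤ 4 / 10000`.
  refine ⟨1 / 10000, by norm_num, ?_⟩
  intro n r hr x s μ α β γ τ κ σr hκ hσr hinc hα hs hαc hβ hγ hτ K Lk xk sk hd hx hinc₀ hrun
  obtain ⟨hrank, U, σ, V, h, hU, hV⟩ := hinc
  set q := μ * ASAP.cs n * r / n with hq
  have hσ0 : 0 < σr := hσr ▸ ASAP.sv_pos_of_lt_rank (by omega)
  have hn : 0 < n := by
    rcases Nat.eq_zero_or_pos n with rfl | h0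
    · have := (ASAP.hankel x).rank_le_height
      simp only [ASAP.rows] at this
      omega
    · exact h0
  have hn0 : (0 : ℝ) < n := by exact_mod_cast hn
  have hqn : q * n = μ * ASAP.cs n * r := by rw [hq]; field_simp
  -- Incoherence forces `μ c_s r ≥ 1`.
  have hq1 := ASAP.one_le_mul_of_rowNormLE h.left_orthonormal hr hU
  have hq0 : 0 < q := by
    by_contra! hneg
    have : q * (ASAP.rows n : ℝ) ≤ 0 := mul_nonpos_of_nonpos_of_nonneg hneg (Nat.cast_nonneg _)
    linarith
  have hqn1 : 1 ≤ q * n := by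
    refine hq1.trans (mul_le_mul_of_nonneg_left ?_ hq0.le)
    have : ASAP.rows n ≤ n := by
      simp only [ASAP.rows]
      omega
    exact_mod_cast this
  have hL : ‖ASAP.hankel x‖ = κ * σr := by
    rw [hκ, ASAP.cond, ← hσr, ASAP.sv_zero_eq_norm, div_mul_cancel₀ _ hσ0.ne']
  have hκ1 : 1 ≤ κ := by
    rw [hκ, ASAP.cond, ← hσr, one_le_div hσ0, hσr]
    exact ASAP.sv_antitone _ (Nat.zero_le _)
  have hκ0 : 0 < κ := by linarith
  have hτ' : τ = 4 * α * (q * n) * κ := by rw [hqn, hτ]; ring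
  have hτκ : 2500 * (κ * τ) ≤ 1 := by
    rw [← hqn, mul_one_div, le_div_iff₀ (by positivity)] at hαc
    have h1 : α * κ ^ 2 * (q * n) * 1 ≤ α * κ ^ 2 * (q * n) * (q * n) :=
      mul_le_mul_of_nonneg_left hqn1 (by positivity)
    rw [hτ']
    nlinarith
  have hrad : (τ - 2 * τ ^ 2) / (8 * α * κ * n) = (1 - 2 * τ) * q / 2 := by
    rw [div_eq_iff (by positivity)]
    linear_combination (1 - 2 * τ) * hτ'
  have hβ' : β = q / (2 * κ) := by
    rw [hβ, hq]
    field_simp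
  have hγ28 : 0.28 ≤ γ := by
    refine le_trans ?_ hγ.1.le
    rw [le_div_iff₀ (by positivity)]
    have : Real.sqrt 12 ≤ 3.5 := Real.sqrt_le_iff.2 (by norm_num)
    linarith
  have hsqrt : Real.sqrt (4 * μ * κ ^ 2 * ASAP.cs n * r / n) = 2 * κ * Real.sqrt q := by
    have e : 4 * μ * κ ^ 2 * ASAP.cs n * r / n = (2 * κ) ^ 2 * q := by rw [hq]; ring
    rw [e, Real.sqrt_mul (by positivity), Real.sqrt_sq (by positivity)]
  intro k
  induction k with
  | zero => exact fun _ => ⟨by simpa using hd, by simpa using hx, hinc₀⟩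
  | succ k ih =>
    intro hk
    obtain ⟨hdk, hxk, hrk, U₀, σ₀, V₀, h₀, hU₀, hV₀⟩ := ih (by omega)
    rw [hsqrt] at hU₀ hV₀
    rw [hrad] at hxk ⊢
    obtain ⟨c1, c2, c3, U', σ', V', h', hU', hV'⟩ := ASAP.isStep_contraction h hr hσ0
      (fun i => hσr ▸ h.sv_le hrank i) (ASAP.rowNormLE_iff.1 hU) (ASAP.rowNormLE_iff.1 hV) hq0 hα
      hs hκ1 hL hβ' hγ28 hγ.2.le hτ' hn hτκ hdk hxk hrk h₀ (ASAP.rowNormLE_iff.1 hU₀)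
      (ASAP.rowNormLE_iff.1 hV₀) (hrun k (by omega))
    have hmono : 2 * Real.sqrt q ≤ 2 * κ * Real.sqrt q :=
      mul_le_mul_of_nonneg_right (by linarith) (Real.sqrt_nonneg q)
    refine ⟨c1, c2, c3, U', σ', V', h', ?_, ?_⟩
    · rw [hsqrt, ASAP.rowNormLE_iff]
      exact fun i => (hU' i).trans hmono
    · rw [hsqrt, ASAP.rowNormLE_iff]
      exact fun i => (hV' i).trans hmono
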